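/- Let $d \ge 2$ and let $(R_0,\mathfrak m_0)$ be a $d$-dimensional regular local ring with field of fractions $K$. A local quadratic transform of a local subring $(A,\mathfrak m)$ of a field is a ring $A[\mathfrak m/y]_{\mathfrak p}$, where $y\in\mathfrak m\setminus\mathfrak m^2$ and $\mathfrak p$ is a prime ideal of $A[\mathfrak m/y]$ with $\mathfrak m\subseteq\mathfrak p$. Let $\{(R_n,\mathfrak m_n)\}_{n\ge 0}$ be an infinite sequence in which each $R_{n+1}$ is a local quadratic transform of $R_n$ and $\dim R_n=d$ for all $n$, and let $S=\bigcup_{n\ge0}R_n$. Let $x\in\mathfrak m_0\setminus\mathfrak m_0^2$ (a regular prime element of $R_0$) be such that $S\subseteq (R_0)_{xR_0}$. Put $P=x(R_0)_{xR_0}\cap S$ and $T=S/P$. A sequence $\{(B_n)\}_{n\ge0}$ of local quadratic transforms of a regular local ring $B_0$ with union $B$ is said to be *height one directed* if there are $j\ge0$ and a height one prime $\mathfrak p$ of $B_j$ with $B\subseteq (B_j)_{\mathfrak p}$, and $(B_j)_{\mathfrak p}=(B_k)_{\mathfrak q}$ whenever $\mathfrak q$ is a height one prime of some $B_k$ with $B\subseteq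 (B_k)_{\mathfrak q}$. It is said to *switch strongly infinitely often* if there are no $j\ge 0$ and height one prime $\mathfrak p$ of $B_j$ with $B\subseteq(B_j)_{\mathfrak p}$. For every $n$ the ideal $P\cap R_n$ is the transform $x_nR_n$ of $xR_0$ in $R_n$ (the unique height one prime of $R_n$ lying over $xR_0$), so that $A_n=R_n/x_nR_n$, with maximal ideal $\mathfrak n_n=\mathfrak m_n/x_nR_n$, is a subring of $T$. Moreover $T=\bigcup_{n\ge0}A_n$, the ring $A_0$ is regular, all $A_n$ have dimension $d-1$, and each $A_{n+1}$ is a local quadratic transform of $A_n$. The following are equivalent: 1. The sequence $\{R_n\}_{n\ge0}$ is height one directed. 2. $S$ is a valuation domain. 3. $T$ is a valuation domain of rank (Krull dimension) one, and an associated real valuation $\nu$ satisfies $\sum_{n\ge0}\nu(\mathfrak n_n)=\infty$, where $\nu(\mathfrak n_n)=\min\{\nu(a): a\in\mathfrak n_n\}$. If $d\ge 3$, these are also equivalent to: 4. The sequence $\{A_n\}_{n\ge0}$ switches strongly infinitely often, and for the associated real valuation $\nu$ (every real valuation of the field of fractions of $T$ with valuation ring $T$; it is unique up to scaling) we have $\sum_{n\ge0}\nu(\mathfrak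 n_n)=\infty$. -/

import Mathlib

open IsLocalRing Filter

/-! ### Local quadratic transforms inside a field -/

/-- The affine chart `A[𝔪/y]` of the blow-up of the maximal ideal `𝔪` of a local subring `A` of a
field: the subring generated by `A` and all quotients `a / y` with `a ∈ 𝔪`. -/
def blowupChart {K : Type*} [Field K] (A : LocalSubring K) (y : A.toSubring) : Subring K :=
  Subring.closure ((A.toSubring : Set K) ∪ {z | ∃ a ∈ maximalIdeal A.toSubring, z = (a : K) / y})

theorem le_blowupChart {K : Type*} [Field K] (A : LocalSubring K) (y : A.toSubring) :
    A.toSubring ≤ blowupChart A y :=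
  fun _ ha => Subring.subset_closure (Or.inl ha)

/-- `B` is a local quadratic transform of `A`: there are `y ∈ 𝔪 \ 𝔪²` and a prime ideal `p` of
`A[𝔪/y]` containing `𝔪` such that `B` is the localization `A[𝔪/y]_p`. -/
def IsLocalQuadraticTransform {K : Type*} [Field K] (A B : LocalSubring K) : Prop :=
  ∃ y : A.toSubring, y ∈ maximalIdeal A.toSubring ∧ y ∉ maximalIdeal A.toSubring ^ 2 ∧
    ∃ p : PrimeSpectrum (blowupChart A y),
      maximalIdeal A.toSubring ≤ p.asIdeal.comap (Subring.inclusion (le_blowupChart A y)) ∧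
      B = LocalSubring.ofPrime (blowupChart A y) p.asIdeal

/-- An infinite sequence of local quadratic transforms of a regular local ring `R 0`, all of whose
members have the same dimension `d`. -/
structure IsQuadraticSequence {K : Type*} [Field K] (d : ℕ) (R : ℕ → LocalSubring K) : Prop where
  regular_zero : IsRegularLocalRing (R 0).toSubring
  dim_eq : ∀ n, ringKrullDim (R n).toSubring = d
  transform : ∀ n, IsLocalQuadraticTransform (R n) (R (n + 1))

/-- The union of an increasing sequence of local subrings of a field (their supremum). -/
def seqUnion {K : Type*} [Field K] (R : ℕ → LocalSubring K) : Subring K :=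
  ⨆ n, (R n).toSubring

theorem le_seqUnion {K : Type*} [Field K] (R : ℕ → LocalSubring K) (n : ℕ) :
    (R n).toSubring ≤ seqUnion R :=
  le_iSup (fun n => (R n).toSubring) n

/-- There are no `j` and height one prime `p` of `R j` with `⋃ R n ⊆ (R j)_p`. -/
def SwitchesStronglyInfinitelyOften {K : Type*} [Field K] (R : ℕ → LocalSubring K) : Prop :=
  ¬ ∃ (j : ℕ) (p : PrimeSpectrum (R j).toSubring), p.asIdeal.height = 1 ∧
      seqUnion R ≤ (LocalSubring.ofPrime (R j).toSubring p.asIdeal).toSubring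

/-- There are `j` and a height one prime `p` of `R j` with `⋃ R n ⊆ (R j)_p`, and the ring
`(R j)_p` is the only one arising in this way. -/
def HeightOneDirected {K : Type*} [Field K] (R : ℕ → LocalSubring K) : Prop :=
  ∃ (j : ℕ) (p : PrimeSpectrum (R j).toSubring), p.asIdeal.height = 1 ∧
    seqUnion R ≤ (LocalSubring.ofPrime (R j).toSubring p.asIdeal).toSubring ∧
    ∀ (k : ℕ) (q : PrimeSpectrum (R k).toSubring), q.asIdeal.height = 1 →
      seqUnion R ≤ (LocalSubring.ofPrime (R k).toSubring q.asIdeal).toSubring →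
      LocalSubring.ofPrime (R j).toSubring p.asIdeal =
        LocalSubring.ofPrime (R k).toSubring q.asIdeal

/-- For subrings `A ⊆ B` of a field and a height one prime `p` of `A`: the proper ideal `q` is the
transform of `p` in `B`, that is, the unique height one prime of `B` with `q ∩ A = p`. -/
def IsPrimeTransform {K : Type*} [Field K] {A B : Subring K} (p : Ideal A) (q : Ideal B) : Prop :=
  ∃ h : A ≤ B,
    (q.IsPrime ∧ q.height = 1 ∧ q.comap (Subring.inclusion h) = p) ∧
    ∀ q' : Ideal B, q'.IsPrime → q'.height = 1 → q'.comap (Subring.inclusion h) = p → q' = q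

/-! ### The residue sequence

Here `W` is a local ring containing `S = ⋃ R n`, with maximal ideal `𝔪_W`; then `P = 𝔪_W ∩ S`,
`T = S / P`, and `A n` is the image of `R n` in `T`, viewed in the field of fractions of `T`. -/

/-- The prime ideal `P = 𝔪_W ∩ S` of `S = ⋃ R n`. -/
def centerIdeal {K : Type*} [Field K] {R : ℕ → LocalSubring K} {W : LocalSubring K}
    (h : seqUnion R ≤ W.toSubring) : Ideal (seqUnion R) :=
  (maximalIdeal W.toSubring).comap (Subring.inclusion h)

instance centerIdeal_isPrime {K : Type*} [Field K] {R : ℕ → LocalSubring K} {W : LocalSubring K}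
    (h : seqUnion R ≤ W.toSubring) : (centerIdeal h).IsPrime :=
  Ideal.comap_isPrime _ _

/-- The domain `T = S / P`. -/
abbrev ResidueUnion {K : Type*} [Field K] {R : ℕ → LocalSubring K} {W : LocalSubring K}
    (h : seqUnion R ≤ W.toSubring) : Type _ :=
  seqUnion R ⧸ centerIdeal h

/-- The map `R n → S → T → Frac T`. -/
noncomputable def residueMap {K : Type*} [Field K] {R : ℕ → LocalSubring K} {W : LocalSubring K}
    (h : seqUnion R ≤ W.toSubring) (n : ℕ) :
    (R n).toSubring →+* FractionRing (ResidueUnion h) :=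
  (algebraMap (ResidueUnion h) (FractionRing (ResidueUnion h))).comp
    ((Ideal.Quotient.mk (centerIdeal h)).comp (Subring.inclusion (le_seqUnion R n)))

/-- The local ring `A n`: the image of `R n` in `T ⊆ Frac T`. -/
noncomputable def residueSeq {K : Type*} [Field K] {R : ℕ → LocalSubring K} {W : LocalSubring K}
    (h : seqUnion R ≤ W.toSubring) (n : ℕ) : LocalSubring (FractionRing (ResidueUnion h)) :=
  LocalSubring.range (residueMap h n)

/-! ### Real valuations -/

/-- `ν` is a real valuation (written additively) of the field `L`, with valuation ring `T`. -/
def IsAssociatedRealValuation {L : Type*} [Field L] (T : Subring L)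
    (ν : AddValuation L (WithTop ℝ)) : Prop :=
  ∀ a : L, a ∈ T ↔ 0 ≤ ν a

/-- `∑ ν(𝔫 n) = ∞`, where `𝔫 n` is the maximal ideal of `A n` and `ν(𝔫 n)`, a real number, is the
least value of `ν` on `𝔫 n`. -/
def ValueSumDiverges {L : Type*} [Field L] (A : ℕ → LocalSubring L)
    (ν : AddValuation L (WithTop ℝ)) : Prop :=
  ∃ c : ℕ → ℝ,
    (∀ n, IsLeast {r : WithTop ℝ | ∃ a ∈ maximalIdeal (A n).toSubring, ν (a : L) = r}
      ((c n : ℝ) : WithTop ℝ)) ∧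
    Tendsto (fun N => ∑ i ∈ Finset.range N, c i) atTop atTop

/-! ### Regular local rings -/

/-! Let `V` be the discrete valuation ring (R₀)_{xR₀}, and let yₙ generate 𝔪ₙRₙ₊₁. Everything rests
on how orders behave under one transform (`exists_quadStep`): if f has order r in Rₙ, then f / yₙ^r
lies in Rₙ₊₁, is not divisible by yₙ and has order at most r. Indeed the chart modulo yₙ is a
polynomial ring over the residue field, because the dimension does not drop; f / yₙ^r becomes there
a nonzero polynomial of degree at most r, and a polynomial has order at most its degree at any
prime. In particular xₙ = x / (y₀⋯yₙ₋₁) keeps order one and generates the center of `V` on Rₙ.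

If the successive transforms of an element keep a constant order r ≥ 1, one of its finitely many
components survives forever, and S lies in a localization at a height one prime
(`exists_height_one_of_constant_order`). If S is not a valuation ring, take among all pairs with the
ratio of two incomparable elements a pair (a, b) of least order r. The combinations of a and b of
order exactly r then have transforms of constant order (`exists_minimal_pair`). So S is a valuation
ring if the sequence switches strongly infinitely often. It is also one if `V` is the only height
one localization above S: then a and b are both divisible by xₙ, and dividing by xₙ lowers r.

Conversely, let S be a valuation ring. Its overrings form a chain, and two comparable overrings of
dimension one of the kind considered coincide, so the sequence is height one directed. Localizing S
at a nonzero nonmaximal prime gives a height one localization of some Rᵢ, hence `V`; so T has rank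
one. Each power of y₀ divides x in S and therefore divides some product y₀⋯yₙ₋₁, which makes the sum
of values diverge. If, finally, the sum diverges but a second ring W = (R_k)_q contains S, an
element of q outside the center of `V` is divisible by y_k⋯y_{k+n-1} for all n, although its value
in T is finite.

For d ≥ 3, condition 4 follows from applying the results on switching sequences to the Aₙ, which
have dimension d - 1 ≥ 2. -/

theorem exists_generators_insert {R : Type*} [CommRing R] [IsLocalRing R] [IsNoetherianRing R]
    {n : ℕ} (h : (maximalIdeal R).spanFinrank = n + 1) {y : R} (hy : y ∈ maximalIdeal R)
    (hy2 : y ∉ maximalIdeal R ^ 2) :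
    ∃ z : Fin n → R, maximalIdeal R = Ideal.span (insert y (Set.range z)) := by
  classical
  obtain ⟨s, hs, hsp⟩ := Submodule.FG.exists_span_finset_card_eq_spanFinrank
    (maximalIdeal R).fg_of_isNoetherianRing
  rw [h] at hs
  have hsp' : Ideal.span (s : Set R) = maximalIdeal R := hsp
  have hy' : y ∈ Ideal.span (s : Set R) := hsp' ▸ hy
  obtain ⟨a, ha⟩ := Submodule.mem_span_finset.1 hy'
  obtain ⟨ha0, hay⟩ := ha
  -- Were all coefficients in 𝔪, y would lie in 𝔪². A generator with unit coefficient can be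
  -- exchanged for y.
  obtain ⟨g, hg, hu⟩ : ∃ g ∈ s, IsUnit (a g) := by
    by_contra! hcon
    apply hy2
    rw [← hay, pow_two]
    refine Ideal.sum_mem _ fun i hi => ?_
    exact Ideal.mul_mem_mul (hcon i hi) (hsp' ▸ Ideal.subset_span hi)
  have hc : (s.erase g).card = n := by rw [Finset.card_erase_of_mem hg, hs]; rfl
  refine ⟨fun i => ((s.erase g).equivFinOfCardEq hc).symm i, ?_⟩
  have hr : Set.range (fun i => (((s.erase g).equivFinOfCardEq hc).symm i : R)) =
      (s.erase g : Finset R) := by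
    ext t
    constructor
    · rintro ⟨i, rfl⟩
      exact (((s.erase g).equivFinOfCardEq hc).symm i).2
    · intro ht
      exact ⟨(s.erase g).equivFinOfCardEq hc ⟨t, ht⟩, by simp⟩
  rw [hr]
  apply le_antisymm
  · rw [← hsp', Ideal.span_le]
    intro t ht
    by_cases htg : t = g
    · subst htg
      obtain ⟨u, hu⟩ := hu
      have this : ↑u⁻¹ * (y - ∑ i ∈ s.erase t, a i • i) = t := by
        rw [← hay, ← Finset.add_sum_erase s _ hg, add_sub_cancel_right, ← hu, smul_eq_mul,
          Units.inv_mul_cancel_left]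
      refine Set.mem_of_eq_of_mem this.symm ?_
      refine Ideal.mul_mem_left _ _ (Ideal.sub_mem _ (Ideal.subset_span (Set.mem_insert _ _)) ?_)
      exact Ideal.sum_mem _ fun i hi => Ideal.mul_mem_left _ _
        (Ideal.subset_span (Set.mem_insert_of_mem _ hi))
    · exact Ideal.subset_span (Set.mem_insert_of_mem _ (Finset.mem_coe.2 (Finset.mem_erase.2 ⟨htg, ht⟩)))
  · rw [Ideal.span_le, Set.insert_subset_iff]
    refine ⟨hy, fun t ht => ?_⟩
    rw [← hsp']
    exact Ideal.subset_span (Finset.mem_of_mem_erase ht)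

theorem maximalIdeal_quotient_eq_map {R : Type*} [CommRing R] [IsLocalRing R] (I : Ideal R)
    [IsLocalRing (R ⧸ I)] :
    maximalIdeal (R ⧸ I) = (maximalIdeal R).map (Ideal.Quotient.mk I) := by
  have hloc := IsLocalHom.of_surjective (Ideal.Quotient.mk I) Ideal.Quotient.mk_surjective
  rw [← IsLocalRing.maximalIdeal_comap (Ideal.Quotient.mk I),
    Ideal.map_comap_of_surjective _ Ideal.Quotient.mk_surjective]

/-- Dividing by a member of a minimal generating set lowers the embedding dimension to at most n,
while the Krull dimension drops by at most one. -/
theorem IsRegularLocalRing.quotient_span_singleton {R : Type*} [CommRing R] [IsRegularLocalRing R]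
    {n : ℕ} (h : ringKrullDim R = (n + 1 : ℕ)) {y : R} (hy : y ∈ maximalIdeal R)
    (hy2 : y ∉ maximalIdeal R ^ 2) :
    IsRegularLocalRing (R ⧸ Ideal.span {y}) ∧ ringKrullDim (R ⧸ Ideal.span {y}) = n := by
  have hne : Ideal.span {y} ≠ ⊤ := fun h => by
    rw [Ideal.span_singleton_eq_top] at h; exact hy h
  have : Nontrivial (R ⧸ Ideal.span {y}) := Ideal.Quotient.nontrivial_iff.2 hne
  have : IsLocalRing (R ⧸ Ideal.span {y}) :=
    IsLocalRing.of_surjective' _ Ideal.Quotient.mk_surjective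
  have hs : (maximalIdeal R).spanFinrank = n + 1 := by
    have := IsRegularLocalRing.spanFinrank_maximalIdeal (R := R)
    rw [h] at this
    exact_mod_cast this
  obtain ⟨z, hz⟩ := exists_generators_insert hs hy hy2
  have hmz : maximalIdeal (R ⧸ Ideal.span {y}) =
      Ideal.span (Set.range fun i => Ideal.Quotient.mk (Ideal.span {y}) (z i)) := by
    rw [maximalIdeal_quotient_eq_map, hz, Ideal.map_span, Set.image_insert_eq,
      Ideal.Quotient.eq_zero_iff_mem.2 (Ideal.mem_span_singleton_self y), Ideal.span_insert_zero,
      ← Set.range_comp]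
    rfl
  have h1 : (maximalIdeal (R ⧸ Ideal.span {y})).spanFinrank ≤ n := by
    rw [hmz]
    refine (Submodule.spanFinrank_span_le_ncard_of_finite (Set.finite_range _)).trans ?_
    have := Set.ncard_image_le (f := fun i => Ideal.Quotient.mk (Ideal.span {y}) (z i))
      (Set.finite_univ)
    rwa [Set.image_univ, Set.ncard_univ, Nat.card_eq_fintype_card, Fintype.card_fin] at this
  have h2 : (n : WithBot ℕ∞) ≤ ringKrullDim (R ⧸ Ideal.span {y}) := by
    have := Ideal.height_le_ringKrullDim_quotient_add_one hy
    rw [IsLocalRing.maximalIdeal_height_eq_ringKrullDim, h] at this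
    push_cast at this
    exact ENat.WithBot.add_le_add_one_right_iff.1 this
  have h3 := ringKrullDim_le_spanFinrank_maximalIdeal (R ⧸ Ideal.span {y})
  have h4 : ((maximalIdeal (R ⧸ Ideal.span {y})).spanFinrank : WithBot ℕ∞) ≤ n := by
    exact_mod_cast h1
  exact ⟨.of_spanFinrank_maximalIdeal_le _ (h4.trans h2), le_antisymm (h3.trans h4) h2⟩

/-- Induction through R / (y), with y outside 𝔪² and all minimal primes. The ideal (y) is prime, and
a minimal prime p below it avoids y, so p = yp and p = 0 by Nakayama. -/
theorem IsRegularLocalRing.isDomain_of_ringKrullDim_eq (n : ℕ) : ∀ (R : Type*) [CommRing R]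
    [IsRegularLocalRing R], ringKrullDim R = n → IsDomain R := by
  induction n with
  | zero =>
    intro R _ _ h
    have hs := IsRegularLocalRing.spanFinrank_maximalIdeal (R := R)
    rw [h] at hs
    have hb : maximalIdeal R = ⊥ := (Submodule.spanFinrank_eq_zero_iff_eq_bot
      (maximalIdeal R).fg_of_isNoetherianRing).1 (by exact_mod_cast hs)
    exact (IsLocalRing.isField_iff_maximalIdeal_eq.2 hb).isDomain
  | succ n ih =>
    intro R _ _ h
    obtain ⟨y, hy, hy2, hmin⟩ : ∃ y ∈ maximalIdeal R, y ∉ maximalIdeal R ^ 2 ∧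
        ∀ p ∈ minimalPrimes R, y ∉ p := by
      by_contra! hcon
      classical
      have hfin := minimalPrimes.finite_of_isNoetherianRing R
      have hsub : (maximalIdeal R : Set R) ⊆
          ⋃ i ∈ ((insert (maximalIdeal R ^ 2) hfin.toFinset : Finset (Ideal R)) : Set (Ideal R)),
            (i : Set R) := by
        intro t ht
        by_cases ht2 : t ∈ maximalIdeal R ^ 2
        · exact Set.mem_biUnion (Finset.mem_insert_self _ _) ht2
        · obtain ⟨p, hp, htp⟩ := hcon t ht ht2
          exact Set.mem_biUnion (Finset.mem_insert_of_mem (hfin.mem_toFinset.2 hp)) htp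
      -- Prime avoidance tolerates two ideals that are not prime; here both slots are taken by 𝔪².
      rw [Ideal.subset_union_prime (f := fun i => i) (maximalIdeal R ^ 2) (maximalIdeal R ^ 2)] at hsub
      · obtain ⟨i, hi, hle⟩ := hsub
        have hnb : maximalIdeal R ≠ ⊥ := by
          intro hb
          have hs := IsRegularLocalRing.spanFinrank_maximalIdeal (R := R)
          rw [h, hb, Submodule.spanFinrank_bot] at hs
          exact absurd hs (by exact_mod_cast (Nat.succ_ne_zero n).symm)
        rcases Finset.mem_insert.1 hi with rfl | hi
        · apply hnb
          refine Submodule.eq_bot_of_le_smul_of_le_jacobson_bot _ _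
            (maximalIdeal R).fg_of_isNoetherianRing ?_ (IsLocalRing.maximalIdeal_le_jacobson _)
          rwa [smul_eq_mul, ← pow_two]
        · have hi' := hfin.mem_toFinset.1 hi
          have hip : i.IsPrime := hi'.1.1
          have := le_antisymm hle (IsLocalRing.le_maximalIdeal hip.ne_top)
          have h0 : (maximalIdeal R).height = 0 := by
            rw [this, Ideal.height_eq_zero_iff]; exact hi'
          have := IsLocalRing.maximalIdeal_height_eq_ringKrullDim (R := R)
          rw [h, h0] at this
          exact absurd this (by exact_mod_cast (Nat.succ_ne_zero n).symm)
      · intro i hi h1 _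
        exact (hfin.mem_toFinset.1 (Finset.mem_of_mem_insert_of_ne hi h1)).1.1
    obtain ⟨hq, hqd⟩ := IsRegularLocalRing.quotient_span_singleton h hy hy2
    have hdom := ih _ hqd
    have hprime : (Ideal.span {y}).IsPrime := (Ideal.Quotient.isDomain_iff_prime _).1 hdom
    obtain ⟨p, hp, hple⟩ := Ideal.exists_minimalPrimes_le (I := ⊥) (J := Ideal.span {y}) bot_le
    have hpp : p.IsPrime := hp.1.1
    have hyp := hmin p hp
    have : p = ⊥ := by
      refine Submodule.eq_bot_of_le_smul_of_le_jacobson_bot (maximalIdeal R) _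
            p.fg_of_isNoetherianRing ?_ (IsLocalRing.maximalIdeal_le_jacobson _)
      intro t ht
      obtain ⟨a, rfl⟩ := Ideal.mem_span_singleton'.1 (hple ht)
      rw [mul_comm a y]
      exact Submodule.smul_mem_smul hy ((hpp.mem_or_mem ht).resolve_right hyp)
    rw [this] at hpp
    have : IsDomain (R ⧸ (⊥ : Ideal R)) := (Ideal.Quotient.isDomain_iff_prime _).2 hpp
    exact (RingEquiv.quotientBot R).symm.toMulEquiv.isDomain _

/-! ### Order of a polynomial at a prime ideal -/

theorem MvPolynomial.le_order_of_mem_pow {σ E : Type*} [Field E] (r : ℕ) :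
    ∀ g : MvPolynomial σ E, g ∈ RingHom.ker (constantCoeff (σ := σ) (R := E)) ^ r →
      (r : ℕ∞) ≤ (g : MvPowerSeries σ E).order := by
  induction r with
  | zero => intro g _; simp
  | succ r ih =>
    intro g hg
    rw [pow_succ] at hg
    refine Submodule.mul_induction_on hg (fun a ha b hb => ?_) (fun a b ha hb => ?_)
    · rw [MvPolynomial.coe_mul]
      refine le_trans ?_ MvPowerSeries.le_order_mul
      push_cast
      refine add_le_add (ih a ha) ?_
      have : ((1 : ℕ) : ℕ∞) ≤ (b : MvPowerSeries σ E).order := by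
        refine MvPowerSeries.nat_le_order fun d hd => ?_
        have : d = 0 := (Finsupp.degree_eq_zero_iff d).1 (by omega)
        subst this
        rw [MvPolynomial.coeff_coe]
        exact hb
      exact_mod_cast this
    · rw [MvPolynomial.coe_add]
      exact le_trans (le_min ha hb) MvPowerSeries.min_order_le_add

theorem MvPolynomial.totalDegree_eval₂Hom_add_C_le {σ k E : Type*} [Field k] [Field E] (ι : k →+* E)
    (a : σ → E) (F : MvPolynomial σ k) :
    (eval₂Hom (C.comp ι) (fun i => X i + C (a i)) F : MvPolynomial σ E).totalDegree ≤
      F.totalDegree := by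
  rw [coe_eval₂Hom, eval₂_eq]
  refine (totalDegree_finsetSum _ _).trans (Finset.sup_le fun α hα => ?_)
  refine (totalDegree_mul _ _).trans ?_
  rw [RingHom.comp_apply, totalDegree_C, zero_add]
  refine (totalDegree_finsetProd _ _).trans (le_trans ?_ (le_totalDegree hα))
  refine Finset.sum_le_sum fun i _ => (totalDegree_pow _ _).trans ?_
  have h1 : (X i + C (a i) : MvPolynomial σ E).totalDegree ≤ 1 :=
    (totalDegree_add _ _).trans (by simp)
  simpa using Nat.mul_le_mul_left (α i) h1

/-- Over E = Frac(k[X]/P) the generic point `a` of P is rational. The translation X ↦ X + a carries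
P into the ideal of the origin, gives S a nonzero constant term and does not raise the degree of F.
A nonzero polynomial of order at least r at the origin has degree at least r. -/
theorem MvPolynomial.le_totalDegree_of_mul_mem_pow {σ k : Type*} [Field k]
    {P : Ideal (MvPolynomial σ k)} [P.IsPrime] {S F : MvPolynomial σ k} (hS : S ∉ P) {r : ℕ}
    (h : S * F ∈ P ^ r) (hF : F ≠ 0) : r ≤ F.totalDegree := by
  let Q := MvPolynomial σ k ⧸ P
  let E := FractionRing Q
  let ev : MvPolynomial σ k →+* E := (algebraMap Q E).comp (Ideal.Quotient.mk P)
  let ι : k →+* E := ev.comp C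
  let a : σ → E := fun i => ev (X i)
  let τ : MvPolynomial σ k →+* MvPolynomial σ E := eval₂Hom (C.comp ι) (fun i => X i + C (a i))
  have hτ : constantCoeff.comp τ = ev := by
    apply MvPolynomial.ringHom_ext
    · intro c; simp [τ, ι]
    · intro i; simp [τ, a]
  have hker : ∀ g, ev g = 0 ↔ g ∈ P := by
    intro g
    simp only [ev, RingHom.comp_apply]
    rw [map_eq_zero_iff _ (IsFractionRing.injective Q E), Ideal.Quotient.eq_zero_iff_mem]
  have hinj : Function.Injective τ := by
    let τ' : MvPolynomial σ E →+* MvPolynomial σ E := eval₂Hom C (fun i => X i - C (a i))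
    have : τ'.comp τ = map ι := by
      apply MvPolynomial.ringHom_ext
      · intro c; simp [τ, τ']
      · intro i; simp [τ, τ']
    have h2 : Function.Injective (τ'.comp τ) := this ▸ map_injective _ ι.injective
    rw [RingHom.coe_comp] at h2
    exact Function.Injective.of_comp h2
  have hmap : P.map τ ≤ RingHom.ker (constantCoeff (σ := σ) (R := E)) := by
    rw [Ideal.map_le_iff_le_comap]
    intro g hg
    rw [Ideal.mem_comap, RingHom.mem_ker, ← RingHom.comp_apply, hτ, hker]
    exact hg
  have h1 : τ S * τ F ∈ RingHom.ker (constantCoeff (σ := σ) (R := E)) ^ r := by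
    rw [← map_mul]
    apply Ideal.pow_right_mono hmap
    rw [← Ideal.map_pow]
    exact Ideal.mem_map_of_mem _ h
  have h2 := MvPolynomial.le_order_of_mem_pow r _ h1
  have h3 : (τ S : MvPowerSeries σ E).order = 0 := by
    rw [← nonpos_iff_eq_zero]
    have : MvPowerSeries.coeff 0 (τ S : MvPowerSeries σ E) ≠ 0 := by
      rw [MvPolynomial.coeff_coe]
      intro h0
      apply hS
      rw [← hker, ← hτ]
      exact h0
    simpa using MvPowerSeries.order_le this
  rw [MvPolynomial.coe_mul, MvPowerSeries.order_mul, h3, zero_add] at h2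
  have h4 : τ F ≠ 0 := (map_ne_zero_iff τ hinj).2 hF
  obtain ⟨d, hd⟩ := MvPolynomial.ne_zero_iff.1 h4
  rw [← MvPolynomial.coeff_coe] at hd
  have h5 := h2.trans (MvPowerSeries.order_le hd)
  rw [MvPolynomial.coeff_coe] at hd
  have h6 : d.degree ≤ (τ F).totalDegree := le_totalDegree (mem_support_iff.2 hd)
  have h7 := MvPolynomial.totalDegree_eval₂Hom_add_C_le ι a F
  exact (by exact_mod_cast h5 : r ≤ d.degree).trans (h6.trans h7)

/-! ### Real valuations from rank one valuation rings -/

/-- In dimension one every nonunit has a power divisible by a given nonzero element, so the value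
group is Archimedean and embeds in ℝ by Hölder's theorem. The sign is reversed because T is where
the multiplicative valuation is at most 1. -/
theorem ValuationRing.exists_real_addValuation (T L : Type*) [CommRing T] [IsDomain T]
    [ValuationRing T] [Field L] [Algebra T L] [IsFractionRing T L] (h : ringKrullDim T = 1) :
    ∃ ν : AddValuation L (WithTop ℝ), ∀ a : L, a ∈ (algebraMap T L).range ↔ 0 ≤ ν a := by
  classical
  let v := ValuationRing.valuation T L
  have hv : ∀ a : L, v a ≤ 1 ↔ ∃ t, algebraMap T L t = a := fun a =>
    ValuationRing.mem_integer_iff T L a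
  have hdim : Ring.KrullDimLE 1 T := by
    rw [Ring.krullDimLE_iff, h]; rfl
  have hroot : ∀ s t : T, s ≠ 0 → ¬ IsUnit t → ∃ n : ℕ, s ∣ t ^ n := by
    intro s t hs ht
    have : t ∈ (Ideal.span {s}).radical := by
      rw [Ideal.radical_eq_sInf, Ideal.mem_sInf]
      rintro J ⟨hJ, hJp⟩
      have hJ0 : J ≠ ⊥ := fun h0 => hs (by
        rw [h0, le_bot_iff, Ideal.span_singleton_eq_bot] at hJ; exact hJ)
      have := hJp.isMaximal_of_ne_bot hJ0
      rw [IsLocalRing.eq_maximalIdeal this]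
      exact ht
    obtain ⟨n, hn⟩ := this
    exact ⟨n, Ideal.mem_span_singleton.1 hn⟩
  have harch : MulArchimedean (ValueGroup T L) := by
    constructor
    intro x y hy
    obtain ⟨b, rfl⟩ : ∃ b, v b = x := Quotient.exists_rep x
    obtain ⟨a, rfl⟩ : ∃ a, v a = y := Quotient.exists_rep y
    obtain ⟨t, ht⟩ : ∃ t, algebraMap T L t = a⁻¹ := by
      rw [← hv, map_inv₀]; exact inv_le_one_of_one_le₀ hy.le
    obtain ⟨c, s, hs, rfl⟩ := IsFractionRing.div_surjective (A := T) b
    have ha0 : a ≠ 0 := by rintro rfl; simp at hy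
    have htu : ¬ IsUnit t := by
      rintro ⟨u, rfl⟩
      have : v a ≤ 1 := by
        rw [hv]
        refine ⟨↑u⁻¹, ?_⟩
        have h1 : algebraMap T L ↑u⁻¹ * algebraMap T L u = 1 := by
          rw [← map_mul]; simp
        rw [ht] at h1
        field_simp at h1
        exact h1
      exact absurd hy this.not_gt
    obtain ⟨n, e, he⟩ := hroot s t (nonZeroDivisors.ne_zero hs) htu
    refine ⟨n, ?_⟩
    have hs0 : algebraMap T L s ≠ 0 := by
      simpa using nonZeroDivisors.ne_zero hs
    have : v (algebraMap T L c / algebraMap T L s * (a⁻¹) ^ n) ≤ 1 := by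
      rw [hv]
      refine ⟨c * e, ?_⟩
      rw [← ht, ← map_pow, he, map_mul, map_mul]
      field_simp
    rw [map_mul, map_pow, map_inv₀, inv_pow, mul_inv_le_iff₀ (pow_pos (zero_lt_one.trans hy) _),
      one_mul] at this
    exact this
  obtain ⟨f, hf⟩ := Archimedean.exists_orderAddMonoidHom_real_injective
    (Additive (ValueGroup T L)ˣ)
  have hv0 : ∀ {a : L}, a ≠ 0 → v a ≠ 0 := fun ha => (Valuation.ne_zero_iff v).2 ha
  let g : (ValueGroup T L)ˣ → ℝ := fun u => f (Additive.ofMul u)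
  have hg1 : g 1 = 0 := f.map_zero
  have hgmul : ∀ u w, g (u * w) = g u + g w := fun u w => f.map_add _ _
  have hgmono : ∀ u w, u ≤ w ↔ g u ≤ g w := fun u w =>
    ((f.monotone'.strictMono_of_injective hf).le_iff_le (a := Additive.ofMul u)
      (b := Additive.ofMul w)).symm
  let ν : L → WithTop ℝ := fun a =>
    if ha : a = 0 then ⊤ else ((-g (Units.mk0 (v a) (hv0 ha)) : ℝ) : WithTop ℝ)
  have hν : ∀ (a : L) (ha : a ≠ 0), ν a = ((-g (Units.mk0 (v a) (hv0 ha)) : ℝ) : WithTop ℝ) :=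
    fun a ha => dif_neg ha
  have hν0 : ν 0 = ⊤ := dif_pos rfl
  have hle : ∀ a b : L, v a ≤ v b ↔ ν b ≤ ν a := by
    intro a b
    by_cases ha : a = 0
    · subst ha; simp [hν0]
    · by_cases hb : b = 0
      · subst hb
        simp [hν0, hν a ha, ha]
      · rw [hν a ha, hν b hb, WithTop.coe_le_coe, neg_le_neg_iff, ← hgmono]
        rfl
  have hone : ν 1 = 0 := by
    rw [hν 1 one_ne_zero]
    have : Units.mk0 (v 1) (hv0 one_ne_zero) = 1 := by ext; simp
    rw [this, hg1]; simp
  refine ⟨AddValuation.of ν hν0 hone ?_ ?_, ?_⟩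
  · intro a b
    rcases le_total (v a) (v b) with hab | hab
    · rw [min_eq_right ((hle _ _).1 hab), ← hle]
      exact (v.map_add a b).trans (max_le hab le_rfl)
    · rw [min_eq_left ((hle _ _).1 hab), ← hle]
      exact (v.map_add a b).trans (max_le le_rfl hab)
  · intro a b
    by_cases ha : a = 0
    · subst ha; simp [hν0]
    by_cases hb : b = 0
    · subst hb; simp [hν0]
    have : Units.mk0 (v (a * b)) (hv0 (mul_ne_zero ha hb)) =
      Units.mk0 (v a) (hv0 ha) * Units.mk0 (v b) (hv0 hb) := by ext; simp
    rw [hν _ ha, hν _ hb, hν _ (mul_ne_zero ha hb), this, hgmul, neg_add]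
    rfl
  · intro a
    rw [AddValuation.of_apply, ← hone, ← hle, map_one, hv]
    rfl

/-! ### Bounds for the embedding dimension -/

/-- D is a quotient of the regular local ring R_P, with P the preimage of the maximal ideal, and the
embedding dimension of R_P is the height of P. -/
theorem spanFinrank_maximalIdeal_le_of_fractions {R D : Type*} [CommRing R] [CommRing D]
    [IsRegularRing R] [IsLocalRing D] (θ : R →+* D)
    (hθ : ∀ d : D, ∃ r s : R, IsUnit (θ s) ∧ d * θ s = θ r) {n : ℕ}
    (hn : ((maximalIdeal D).comap θ).height ≤ n) :
    (maximalIdeal D).spanFinrank ≤ n := by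
  let P := (maximalIdeal D).comap θ
  let f : Localization.AtPrime P →+* D := IsLocalization.lift (M := P.primeCompl) (g := θ)
    (fun s => by
      have : θ s ∉ maximalIdeal D := s.2
      simpa using this)
  have hf : ∀ r, f (algebraMap R _ r) = θ r := fun r => IsLocalization.lift_eq _ r
  have hsurj : Function.Surjective f := by
    intro d
    obtain ⟨r, s, hs, hd⟩ := hθ d
    refine ⟨IsLocalization.mk' _ r (⟨s, fun h : θ s ∈ maximalIdeal D => h hs⟩ : P.primeCompl), ?_⟩
    rw [IsLocalization.lift_mk'_spec, ← hd, mul_comm]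
  have hloc : IsLocalHom f := IsLocalHom.of_surjective f hsurj
  have hm : maximalIdeal D = (maximalIdeal (Localization.AtPrime P)).map f := by
    rw [← IsLocalRing.maximalIdeal_comap f, Ideal.map_comap_of_surjective _ hsurj]
  have hreg : IsRegularLocalRing (Localization.AtPrime P) := inferInstance
  have h1 := hreg.spanFinrank_maximalIdeal
  rw [IsLocalization.AtPrime.ringKrullDim_eq_height P] at h1
  have h2 : (maximalIdeal (Localization.AtPrime P)).spanFinrank ≤ n := by
    have : ((maximalIdeal (Localization.AtPrime P)).spanFinrank : ℕ∞) ≤ n := by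
      refine le_trans (le_of_eq ?_) hn
      exact WithBot.coe_injective h1
    exact_mod_cast this
  rw [hm]
  exact (Ideal.spanFinrank_map_le_of_fg f (maximalIdeal _).fg_of_isNoetherianRing).trans h2

theorem spanFinrank_maximalIdeal_le_quotient_add_one {C : Type*} [CommRing C] [IsLocalRing C]
    [IsNoetherianRing C] {y : C} [IsLocalRing (C ⧸ Ideal.span {y})] :
    (maximalIdeal C).spanFinrank ≤ (maximalIdeal (C ⧸ Ideal.span {y})).spanFinrank + 1 := by
  classical
  obtain ⟨s, hs, hsp⟩ := Submodule.FG.exists_span_finset_card_eq_spanFinrank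
    (maximalIdeal (C ⧸ Ideal.span {y})).fg_of_isNoetherianRing
  let g := Function.surjInv (Ideal.Quotient.mk_surjective (I := Ideal.span {y}))
  have hg : ∀ t, Ideal.Quotient.mk (Ideal.span {y}) (g t) = t := Function.surjInv_eq _
  have hm : maximalIdeal C = Ideal.span ((insert y (s.image g) : Finset C) : Set C) := by
    have h1 : (Ideal.span (s.image g : Set C)).map (Ideal.Quotient.mk (Ideal.span {y})) =
        maximalIdeal (C ⧸ Ideal.span {y}) := by
      rw [Ideal.map_span, Finset.coe_image, ← Set.image_comp]
      have : (Ideal.Quotient.mk (Ideal.span {y})) ∘ g = id := funext hg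
      rw [this, Set.image_id]
      exact hsp
    have h2 := congrArg (Ideal.comap (Ideal.Quotient.mk (Ideal.span {y}))) h1
    have hloc := IsLocalHom.of_surjective (Ideal.Quotient.mk (Ideal.span {y}))
      Ideal.Quotient.mk_surjective
    rw [IsLocalRing.maximalIdeal_comap, Ideal.comap_map_of_surjective _
      Ideal.Quotient.mk_surjective, ← RingHom.ker_eq_comap_bot, Ideal.mk_ker] at h2
    rw [← h2, Finset.coe_insert, Ideal.span_insert, sup_comm, Finset.coe_image]
  have h3 := Submodule.spanFinrank_span_le_ncard_of_finite (R := C)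
    (insert y (s.image g) : Finset C).finite_toSet
  rw [hm]
  refine h3.trans ?_
  rw [Set.ncard_coe_finset, ← hs]
  exact (Finset.card_insert_le _ _).trans (Nat.succ_le_succ Finset.card_image_le)

/-! ### Powers of the maximal ideal, as subsets of the field -/

namespace LocalSubring

variable {K : Type*} [Field K]

/-- The power `𝔪 ^ r` of the maximal ideal of a local subring, as a subset of the field. -/
def maxPow (A : LocalSubring K) (r : ℕ) : Set K :=
  {z | ∃ h : z ∈ A.toSubring, (⟨z, h⟩ : A.toSubring) ∈ maximalIdeal A.toSubring ^ r}

variable {A W : LocalSubring K} {r s : ℕ} {a b : K}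

theorem coe_mem_maxPow {a : A.toSubring} :
    (a : K) ∈ A.maxPow r ↔ a ∈ maximalIdeal A.toSubring ^ r :=
  ⟨fun ⟨_, h⟩ => h, fun h => ⟨a.2, h⟩⟩

theorem coe_mem_maxPow_one {a : A.toSubring} :
    (a : K) ∈ A.maxPow 1 ↔ a ∈ maximalIdeal A.toSubring := by
  rw [coe_mem_maxPow, pow_one]

theorem mem_maxPow_zero : a ∈ A.maxPow 0 ↔ a ∈ A.toSubring :=
  ⟨fun h => h.1, fun h => ⟨h, by simp⟩⟩

theorem maxPow_anti (h : r ≤ s) (ha : a ∈ A.maxPow s) : a ∈ A.maxPow r :=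
  ⟨ha.1, Ideal.pow_le_pow_right h ha.2⟩

theorem mul_mem_maxPow (ha : a ∈ A.maxPow r) (hb : b ∈ A.maxPow s) : a * b ∈ A.maxPow (r + s) :=
  ⟨mul_mem ha.1 hb.1, by
    rw [pow_add]
    exact Ideal.mul_mem_mul ha.2 hb.2⟩

theorem mul_mem_maxPow_left (ha : a ∈ A.toSubring) (hb : b ∈ A.maxPow s) : a * b ∈ A.maxPow s := by
  simpa using mul_mem_maxPow (mem_maxPow_zero.2 ha) hb

theorem mul_mem_maxPow_right (ha : a ∈ A.maxPow r) (hb : b ∈ A.toSubring) : a * b ∈ A.maxPow r :=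
  mul_comm b a ▸ mul_mem_maxPow_left hb ha

theorem add_mem_maxPow (ha : a ∈ A.maxPow r) (hb : b ∈ A.maxPow r) : a + b ∈ A.maxPow r :=
  ⟨add_mem ha.1 hb.1, Ideal.add_mem _ ha.2 hb.2⟩

theorem neg_mem_maxPow (ha : a ∈ A.maxPow r) : -a ∈ A.maxPow r :=
  ⟨neg_mem ha.1, Ideal.neg_mem_iff _ |>.2 ha.2⟩

theorem sub_mem_maxPow (ha : a ∈ A.maxPow r) (hb : b ∈ A.maxPow r) : a - b ∈ A.maxPow r :=
  sub_eq_add_neg a b ▸ add_mem_maxPow ha (neg_mem_maxPow hb)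

theorem zero_mem_maxPow : (0 : K) ∈ A.maxPow r := ⟨zero_mem _, Ideal.zero_mem _⟩

theorem mem_maxPow_one_iff : a ∈ A.maxPow 1 ↔ a ∈ A.toSubring ∧ (a = 0 ∨ a⁻¹ ∉ A.toSubring) := by
  constructor
  · rintro ⟨h, h1⟩
    refine ⟨h, ?_⟩
    by_contra! hcon
    rw [pow_one] at h1
    exact h1 (IsUnit.of_mul_eq_one (⟨a⁻¹, hcon.2⟩ : A.toSubring)
      (Subtype.ext (mul_inv_cancel₀ hcon.1)))
  · rintro ⟨h, h1⟩
    refine ⟨h, ?_⟩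
    rw [pow_one]
    intro hu
    obtain ⟨u, hu⟩ := hu
    have h2 : a * ((↑u⁻¹ : A.toSubring) : K) = 1 := by
      have : (⟨a, h⟩ : A.toSubring) * ↑u⁻¹ = 1 := by rw [← hu]; simp
      exact congrArg Subtype.val this
    rcases h1 with rfl | h1
    · simp at h2
    · exact h1 (by rw [inv_eq_of_mul_eq_one_right h2]; exact (↑u⁻¹ : A.toSubring).2)

theorem inv_mem (ha : a ∈ A.toSubring) (h : a ∉ A.maxPow 1) : a⁻¹ ∈ A.toSubring := by
  by_contra hcon
  exact h (mem_maxPow_one_iff.2 ⟨ha, Or.inr hcon⟩)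

theorem ne_zero_of_not_mem (h : a ∉ A.maxPow r) : a ≠ 0 := by
  rintro rfl
  exact h zero_mem_maxPow

theorem not_mem_maxPow_one (ha : a ≠ 0) (h : a⁻¹ ∈ A.toSubring) : a ∉ A.maxPow 1 := fun h1 =>
  (mem_maxPow_one_iff.1 h1).2.elim ha fun h2 => h2 h

theorem one_not_mem_maxPow : (1 : K) ∉ A.maxPow 1 :=
  not_mem_maxPow_one one_ne_zero (by simp [one_mem])

theorem exists_order [IsNoetherianRing A.toSubring] (ha : a ∈ A.toSubring) (h0 : a ≠ 0) :
    ∃ r, a ∈ A.maxPow r ∧ a ∉ A.maxPow (r + 1) := by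
  by_contra! hcon
  have h : ∀ r, a ∈ A.maxPow r := fun r =>
    Nat.rec (mem_maxPow_zero.2 ha) (fun n hn => hcon n hn) r
  have h1 : (⟨a, ha⟩ : A.toSubring) ∈ (⨅ i : ℕ, maximalIdeal A.toSubring ^ i : Ideal A.toSubring) :=
    (Submodule.mem_iInf _).2 fun i => (h i).2
  rw [Ideal.iInf_pow_eq_bot_of_isLocalRing _ (maximalIdeal.isMaximal _).ne_top] at h1
  exact h0 (congrArg Subtype.val (Ideal.mem_bot.1 h1))

/-! ### Localizations of subrings -/

theorem mem_ofPrime {B : Subring K} {P : Ideal B} [P.IsPrime] {z : K} :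
    z ∈ (ofPrime B P).toSubring ↔ ∃ a s : B, s ∉ P ∧ z = a / s := by
  constructor
  · intro hz
    obtain ⟨⟨a, s⟩, h⟩ := IsLocalization.surj P.primeCompl (⟨z, hz⟩ : (ofPrime B P).toSubring)
    refine ⟨a, s, s.2, ?_⟩
    have h1 : z * (s : B) = a := congrArg Subtype.val h
    have hs : ((s : B) : K) ≠ 0 := fun h0 => s.2 (by
      have : (s : B) = 0 := Subtype.ext h0
      rw [this]; exact P.zero_mem)
    rw [← h1]; field_simp
  · rintro ⟨a, s, hs, rfl⟩
    have hs0 : (s : K) ≠ 0 := fun h0 => hs (by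
      have : s = 0 := Subtype.ext h0
      rw [this]; exact P.zero_mem)
    have h := IsLocalization.mk'_spec (ofPrime B P).toSubring a (⟨s, hs⟩ : P.primeCompl)
    have h1 : ((IsLocalization.mk' (ofPrime B P).toSubring a (⟨s, hs⟩ : P.primeCompl)) : K) * s = a :=
      congrArg Subtype.val h
    rw [← h1, mul_div_cancel_right₀ _ hs0]
    exact SetLike.coe_mem _

theorem coe_ne_zero_of_not_mem {B : Subring K} {P : Ideal B} {s : B} (hs : s ∉ P) : (s : K) ≠ 0 :=
  fun h0 => hs (by
    have : s = 0 := Subtype.ext h0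
    rw [this]; exact P.zero_mem)

theorem mem_maxPow_ofPrime {B : Subring K} {P : Ideal B} [P.IsPrime] {a : B} :
    (a : K) ∈ (ofPrime B P).maxPow 1 ↔ a ∈ P := by
  have h := IsLocalization.AtPrime.to_map_mem_maximal_iff (ofPrime B P).toSubring P a
  rw [← h, ← coe_mem_maxPow_one]
  rfl

/-- The center of a local ring `W` on a subring `B`. -/
def center (W : LocalSubring K) {B : Subring K} (h : B ≤ W.toSubring) : Ideal B :=
  (maximalIdeal W.toSubring).comap (Subring.inclusion h)

instance center_isPrime (W : LocalSubring K) {B : Subring K} (h : B ≤ W.toSubring) :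
    (W.center h).IsPrime := Ideal.comap_isPrime _ _

theorem mem_center {B : Subring K} {h : B ≤ W.toSubring} {a : B} :
    a ∈ W.center h ↔ (a : K) ∈ W.maxPow 1 :=
  (coe_mem_maxPow_one (A := W) (a := Subring.inclusion h a)).symm

theorem center_ofPrime {B : Subring K} {P : Ideal B} [P.IsPrime] :
    (ofPrime B P).center (le_ofPrime B P) = P := by
  ext a
  rw [mem_center, mem_maxPow_ofPrime]

/-- Recognizes W as a localization of B: denominators that are units of W lie outside the center,
and elements outside the center are units of W. -/
theorem ofPrime_center_eq {B : Subring K} (h : B ≤ W.toSubring)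
    (hW : ∀ c ∈ W.toSubring, ∃ a ∈ B, ∃ s ∈ B, s ≠ 0 ∧ s⁻¹ ∈ W.toSubring ∧ c = a / s) :
    ofPrime B (W.center h) = W := by
  apply toSubring_injective
  apply le_antisymm
  · intro z hz
    obtain ⟨a, s, hs, rfl⟩ := mem_ofPrime.1 hz
    rw [mem_center] at hs
    rw [div_eq_mul_inv]
    exact mul_mem (h a.2) (inv_mem (h s.2) hs)
  · intro z hz
    obtain ⟨a, ha, s, hs, hs0, hsi, rfl⟩ := hW z hz
    exact mem_ofPrime.2 ⟨⟨a, ha⟩, ⟨s, hs⟩, fun h1 => not_mem_maxPow_one hs0 hsi (mem_center.1 h1), rfl⟩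

theorem ofPrime_center_of_le {A C : Subring K} {q : Ideal A} [q.IsPrime] (hAC : A ≤ C)
    (h : C ≤ (ofPrime A q).toSubring) : ofPrime C ((ofPrime A q).center h) = ofPrime A q := by
  apply ofPrime_center_eq
  intro c hc
  obtain ⟨a, s, hs, rfl⟩ := mem_ofPrime.1 hc
  have hs0 := coe_ne_zero_of_not_mem hs
  refine ⟨a, hAC a.2, s, hAC s.2, hs0, ?_, rfl⟩
  exact inv_mem (le_ofPrime A q s.2) (by rwa [mem_maxPow_ofPrime])

theorem ringKrullDim_ofPrime {B : Subring K} {P : Ideal B} [P.IsPrime] :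
    ringKrullDim (ofPrime B P).toSubring = P.height :=
  IsLocalization.AtPrime.ringKrullDim_eq_height P _

theorem isNoetherianRing_ofPrime {B : Subring K} [IsNoetherianRing B] (P : Ideal B) [P.IsPrime] :
    IsNoetherianRing (ofPrime B P).toSubring :=
  IsLocalization.isNoetherianRing P.primeCompl _ inferInstance

/-- Both heights are the dimension of A_q, which is also the localization of C at the center. -/
theorem center_height_eq {A C : Subring K} {q : Ideal A} [q.IsPrime] (hAC : A ≤ C)
    (h : C ≤ (ofPrime A q).toSubring) : ((ofPrime A q).center h).height = q.height := by
  have h1 := ringKrullDim_ofPrime (B := C) (P := (ofPrime A q).center h)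
  rw [ofPrime_center_of_le hAC h, ringKrullDim_ofPrime] at h1
  exact (WithBot.coe_injective h1).symm

/-! ### Valuation rings -/

theorem _root_.Subring.valuationRing_iff {B : Subring K} :
    ValuationRing B ↔ ∀ a ∈ B, ∀ b ∈ B, a ≠ 0 → b ≠ 0 → a / b ∈ B ∨ b / a ∈ B := by
  rw [ValuationRing.iff_dvd_total]
  constructor
  · rintro ⟨h⟩ a ha b hb ha0 hb0
    rcases h ⟨a, ha⟩ ⟨b, hb⟩ with ⟨c, hc⟩ | ⟨c, hc⟩
    · right
      have : b = a * c := congrArg Subtype.val hc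
      rw [this, mul_div_cancel_left₀ _ ha0]; exact c.2
    · left
      have : a = b * c := congrArg Subtype.val hc
      rw [this, mul_div_cancel_left₀ _ hb0]; exact c.2
  · intro h
    refine ⟨fun a b => ?_⟩
    by_cases ha0 : (a : K) = 0
    · right
      exact ⟨0, Subtype.ext (by simp [ha0])⟩
    by_cases hb0 : (b : K) = 0
    · left
      exact ⟨0, Subtype.ext (by simp [hb0])⟩
    rcases h a a.2 b b.2 ha0 hb0 with h | h
    · exact Or.inr ⟨⟨_, h⟩, Subtype.ext (by simp; field_simp)⟩
    · exact Or.inl ⟨⟨_, h⟩, Subtype.ext (by simp; field_simp)⟩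

/-- The elements of `W` are fractions of elements of `B`. -/
def FractionsOf (W B : Subring K) : Prop :=
  ∀ c ∈ W, ∃ a ∈ B, ∃ s ∈ B, s ≠ 0 ∧ c = a / s

theorem FractionsOf.mono {W B B' : Subring K} (h : FractionsOf W B) (hB : B ≤ B') :
    FractionsOf W B' := fun c hc =>
  let ⟨a, ha, s, hs, h0, e⟩ := h c hc
  ⟨a, hB ha, s, hB hs, h0, e⟩

theorem fractionsOf_ofPrime (B : Subring K) (P : Ideal B) [P.IsPrime] :
    FractionsOf (ofPrime B P).toSubring B := fun _ hc =>
  let ⟨a, s, hs, e⟩ := mem_ofPrime.1 hc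
  ⟨a, a.2, s, s.2, coe_ne_zero_of_not_mem hs, e⟩

theorem FractionsOf.div_mem {W B : Subring K} (hW : FractionsOf W B) [hB : ValuationRing B]
    {a b : K} (ha : a ∈ W) (hb : b ∈ W) (ha0 : a ≠ 0) (hb0 : b ≠ 0) :
    a / b ∈ B ∨ b / a ∈ B := by
  rw [Subring.valuationRing_iff] at hB
  obtain ⟨a, ha', s, hs, hs0, rfl⟩ := hW a ha
  obtain ⟨b, hb', t, ht, ht0, rfl⟩ := hW b hb
  have ha1 : a ≠ 0 := fun h => ha0 (by simp [h])
  have hb1 : b ≠ 0 := fun h => hb0 (by simp [h])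
  rcases hB _ (mul_mem ha' ht) _ (mul_mem hb' hs) (mul_ne_zero ha1 ht0) (mul_ne_zero hb1 hs0)
    with h | h
  · left; convert h using 1; field_simp
  · right; convert h using 1; field_simp

theorem FractionsOf.valuationRing {W B : Subring K} (hW : FractionsOf W B) [ValuationRing B]
    (hBW : B ≤ W) : ValuationRing W := by
  rw [Subring.valuationRing_iff]
  intro a ha b hb ha0 hb0
  exact (hW.div_mem ha hb ha0 hb0).imp (fun h => hBW h) (fun h => hBW h)

/-- For v in V \ W and w in W \ V, one of v / w and w / v lies in B. Then v = (v / w) w is in W, or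
symmetrically w is in V. -/
theorem FractionsOf.le_total {V W B : Subring K} (hV : FractionsOf V B) (hW : FractionsOf W B)
    [hB : ValuationRing B] (hBV : B ≤ V) (hBW : B ≤ W) : V ≤ W ∨ W ≤ V := by
  by_contra! hcon
  obtain ⟨v, hv, hvW⟩ := Set.not_subset.1 hcon.1
  obtain ⟨w, hw, hwV⟩ := Set.not_subset.1 hcon.2
  have hv0 : v ≠ 0 := by rintro rfl; exact hvW W.zero_mem
  have hw0 : w ≠ 0 := by rintro rfl; exact hwV V.zero_mem
  have key : ∀ c ∈ V, ∀ e ∈ W, c ≠ 0 → e ≠ 0 → c / e ∈ B ∨ e / c ∈ B := by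
    intro c hc e he hc0 he0
    rw [Subring.valuationRing_iff] at hB
    obtain ⟨a, ha, s, hs, hs0, rfl⟩ := hV c hc
    obtain ⟨b, hb, t, ht, ht0, rfl⟩ := hW e he
    have ha1 : a ≠ 0 := fun h => hc0 (by simp [h])
    have hb1 : b ≠ 0 := fun h => he0 (by simp [h])
    rcases hB _ (mul_mem ha ht) _ (mul_mem hb hs) (mul_ne_zero ha1 ht0) (mul_ne_zero hb1 hs0)
      with h | h
    · left; convert h using 1; field_simp
    · right; convert h using 1; field_simp
  rcases key v hv w hw hv0 hw0 with h | h
  · exact hvW (div_mul_cancel₀ v hw0 ▸ mul_mem (hBW h) hw)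
  · exact hwV (div_mul_cancel₀ w hv0 ▸ mul_mem (hBV h) hv)

/-- The center of W on V is a nonzero prime, hence maximal. The inverse of an element of W outside V
is a nonunit of V, so it would be a nonunit of W. -/
theorem eq_of_le_of_ringKrullDim_le_one {V W : LocalSubring K} (hle : V.toSubring ≤ W.toSubring)
    [hV : ValuationRing V.toSubring] (hdim : ringKrullDim V.toSubring ≤ 1)
    (hfrac : FractionsOf W.toSubring V.toSubring) {a : K} (ha : a ∈ V.toSubring) (ha0 : a ≠ 0)
    (haW : a ∈ W.maxPow 1) : V = W := by
  have hd : Ring.KrullDimLE 1 V.toSubring := by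
    rw [Ring.krullDimLE_iff]; exact_mod_cast hdim
  have hmax : (W.center hle).IsMaximal := by
    refine Ideal.IsPrime.isMaximal_of_ne_bot inferInstance fun h0 => ha0 ?_
    have : (⟨a, ha⟩ : V.toSubring) ∈ W.center hle := mem_center.2 haW
    rw [h0] at this
    exact congrArg Subtype.val (Ideal.mem_bot.1 this)
  have hm := IsLocalRing.eq_maximalIdeal hmax
  apply toSubring_injective
  refine le_antisymm hle fun w hw => ?_
  by_contra hwV
  have hw0 : w ≠ 0 := by rintro rfl; exact hwV (zero_mem _)
  have h1 := hfrac.div_mem hw (one_mem _) hw0 one_ne_zero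
  rw [div_one] at h1
  have h2 := h1.resolve_left hwV
  rw [one_div] at h2
  have h3 : w⁻¹ ∈ V.maxPow 1 := mem_maxPow_one_iff.2 ⟨h2, Or.inr (by rwa [inv_inv])⟩
  have h4 : w⁻¹ ∈ W.maxPow 1 := by
    rw [← mem_center (h := hle) (a := ⟨_, h2⟩), hm, ← coe_mem_maxPow_one]
    exact h3
  exact not_mem_maxPow_one (inv_ne_zero hw0) (by rwa [inv_inv]) h4

end LocalSubring

/-! ### The affine charts of the blow-up of the maximal ideal -/

section Chart

open MvPolynomial

variable {A B : Type*} [CommRing A] [IsLocalRing A] [CommRing B] {ι : A →+* B} {n : ℕ} {y : A}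
  {z : Fin n → A} {t : Fin n → B}

/-- B stands for A[𝔪/y] and `t i` for z i / y. The map ψ describes the fibre of the chart over the
closed point; it exists because 𝔪 becomes zero modulo y. -/
theorem exists_chartMap (hz : maximalIdeal A = Ideal.span (insert y (Set.range z)))
    (ht : ∀ i, ι (z i) = ι y * t i) :
    ∃ ψ : MvPolynomial (Fin n) (ResidueField A) →+* B ⧸ Ideal.span {ι y},
      ∀ F, ψ (MvPolynomial.map (residue A) F) = Ideal.Quotient.mk _ (eval₂Hom ι t F) := by
  have h0 : ∀ a ∈ maximalIdeal A, (Ideal.Quotient.mk (Ideal.span {ι y})).comp ι a = 0 := by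
    have : maximalIdeal A ≤ RingHom.ker ((Ideal.Quotient.mk (Ideal.span {ι y})).comp ι) := by
      rw [hz, Ideal.span_le]
      rintro a (rfl | ⟨i, rfl⟩)
      · exact Ideal.Quotient.eq_zero_iff_mem.2 (Ideal.mem_span_singleton_self _)
      · refine Ideal.Quotient.eq_zero_iff_mem.2 ?_
        rw [ht]
        exact Ideal.mul_mem_right _ _ (Ideal.mem_span_singleton_self _)
    exact fun a ha => this ha
  obtain ⟨κ, hκ⟩ : ∃ κ : ResidueField A →+* B ⧸ Ideal.span {ι y},
      ∀ a, κ (residue A a) = Ideal.Quotient.mk _ (ι a) :=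
    ⟨Ideal.Quotient.lift (maximalIdeal A) _ h0, fun a => Ideal.Quotient.lift_mk (maximalIdeal A) _ h0⟩
  refine ⟨eval₂Hom κ (fun i => Ideal.Quotient.mk _ (t i)), fun F => ?_⟩
  have : (eval₂Hom κ (fun i => Ideal.Quotient.mk (Ideal.span {ι y}) (t i))).comp
      (MvPolynomial.map (residue A)) =
      (Ideal.Quotient.mk (Ideal.span {ι y})).comp (eval₂Hom ι t) := by
    apply MvPolynomial.ringHom_ext
    · intro a
      rw [RingHom.comp_apply, RingHom.comp_apply, MvPolynomial.map_C, eval₂Hom_C, eval₂Hom_C, hκ]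
    · intro i
      rw [RingHom.comp_apply, RingHom.comp_apply, MvPolynomial.map_X, eval₂Hom_X', eval₂Hom_X']
  exact congrArg (fun f => f F) this

variable {ψ : MvPolynomial (Fin n) (ResidueField A) →+* B ⧸ Ideal.span {ι y}}

theorem chartMap_surjective
    (hψ : ∀ F, ψ (MvPolynomial.map (residue A) F) = Ideal.Quotient.mk _ (eval₂Hom ι t F))
    (hsurj : Function.Surjective (eval₂Hom ι t)) : Function.Surjective ψ := by
  intro q
  obtain ⟨b, rfl⟩ := Ideal.Quotient.mk_surjective q
  obtain ⟨F, rfl⟩ := hsurj b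
  exact ⟨_, hψ F⟩

theorem ringKrullDim_mvPolynomial_field (k : Type*) [Field k] (n : ℕ) :
    ringKrullDim (MvPolynomial (Fin n) k) = n := by
  rw [MvPolynomial.ringKrullDim_of_isNoetherianRing, ringKrullDim_eq_zero_of_field]
  simp

/-- A nonzero element of the kernel would bound dim B / (y) by n - 1, but a prime of height at least
n + 1 through y forces it to be at least n. Keeping the dimension in the transform serves this
purpose. -/
theorem chartMap_injective
    (hψ : ∀ F, ψ (MvPolynomial.map (residue A) F) = Ideal.Quotient.mk _ (eval₂Hom ι t F))
    (hsurj : Function.Surjective (eval₂Hom ι t)) [IsNoetherianRing B] {p : Ideal B} [p.IsPrime] (hy : ι y ∈ p)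
    (hp : (n + 1 : ℕ) ≤ p.height) : Function.Injective ψ := by
  rw [injective_iff_map_eq_zero]
  intro F hF
  by_contra hF0
  have h1 := ringKrullDim_succ_le_of_surjective ψ (chartMap_surjective hψ hsurj)
    (mem_nonZeroDivisors_of_ne_zero hF0) hF
  rw [ringKrullDim_mvPolynomial_field] at h1
  have h2 := (Ideal.height_le_ringKrullDim_quotient_add_one hy).trans h1
  have h3 : ((n + 1 : ℕ) : WithBot ℕ∞) ≤ n := le_trans (by exact_mod_cast hp) h2
  have h4 : n + 1 ≤ n := by exact_mod_cast h3
  omega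

/-- A form of degree `r` in `y, z` is `y ^ r` times a polynomial in `t = z / y`. -/
theorem exists_dehomogenization (hz : maximalIdeal A = Ideal.span (insert y (Set.range z)))
    (ht : ∀ i, ι (z i) = ι y * t i) (r : ℕ) :
    ∀ f ∈ maximalIdeal A ^ r, ∃ F : MvPolynomial (Fin n) A, F.totalDegree ≤ r ∧
      ι f = ι y ^ r * eval₂Hom ι t F := by
  have h1 : ∀ a ∈ maximalIdeal A, ∃ F : MvPolynomial (Fin n) A, F.totalDegree ≤ 1 ∧
      ι a = ι y * eval₂Hom ι t F := by
    intro a ha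
    rw [hz] at ha
    refine Submodule.span_induction ?_ ⟨0, by simp⟩ ?_ ?_ ha
    · rintro a (rfl | ⟨i, rfl⟩)
      · exact ⟨1, by simp⟩
      · exact ⟨X i, by simp, by simp [ht]⟩
    · rintro a b _ _ ⟨F, hF, ha⟩ ⟨G, hG, hb⟩
      exact ⟨F + G, (totalDegree_add _ _).trans (max_le hF hG), by
        rw [map_add, ha, hb, map_add, mul_add]⟩
    · rintro c a _ ⟨F, hF, ha⟩
      refine ⟨C c * F, (totalDegree_mul _ _).trans (by rw [totalDegree_C, zero_add]; exact hF), ?_⟩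
      rw [smul_eq_mul, map_mul, ha, map_mul, eval₂Hom_C]; ring
  induction r with
  | zero => intro f _; exact ⟨C f, by simp, by simp⟩
  | succ r ih =>
    intro f hf
    rw [pow_succ] at hf
    refine Submodule.mul_induction_on hf ?_ ?_
    · intro a ha b hb
      obtain ⟨F, hF, ha⟩ := ih a ha
      obtain ⟨G, hG, hb⟩ := h1 b hb
      exact ⟨F * G, (totalDegree_mul _ _).trans (add_le_add hF hG), by
        rw [map_mul, ha, hb, map_mul]; ring⟩
    · rintro a b ⟨F, hF, ha⟩ ⟨G, hG, hb⟩
      exact ⟨F + G, (totalDegree_add _ _).trans (max_le hF hG), by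
        rw [map_add, ha, hb, map_add, mul_add]⟩

/-- Multiplying by y ^ r turns the monomials of F into forms of degree r in y, z; the coefficients,
lying in 𝔪, contribute one more factor. -/
theorem exists_homogenization (hz : maximalIdeal A = Ideal.span (insert y (Set.range z)))
    (ht : ∀ i, ι (z i) = ι y * t i) {r : ℕ} {F : MvPolynomial (Fin n) A} (hF : F.totalDegree ≤ r)
    (hF0 : MvPolynomial.map (residue A) F = 0) :
    ∃ g ∈ maximalIdeal A ^ (r + 1), ι g = ι y ^ r * eval₂Hom ι t F := by
  have hy : y ∈ maximalIdeal A := hz ▸ Ideal.subset_span (Set.mem_insert _ _)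
  have hzi : ∀ i, z i ∈ maximalIdeal A := fun i =>
    hz ▸ Ideal.subset_span (Set.mem_insert_of_mem _ ⟨i, rfl⟩)
  refine ⟨∑ α ∈ F.support, F.coeff α * (y ^ (r - α.sum fun _ e => e) * ∏ i, z i ^ α i), ?_, ?_⟩
  · refine Ideal.sum_mem _ fun α hα => ?_
    rw [pow_succ']
    refine Ideal.mul_mem_mul ?_ ?_
    · have := congrArg (coeff α) hF0
      rw [coeff_map, coeff_zero] at this
      exact (residue_eq_zero_iff _).1 this
    · have hle : (α.sum fun _ e => e) ≤ r := (le_totalDegree hα).trans hF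
      have h2 : ∏ i, z i ^ α i ∈ maximalIdeal A ^ (α.sum fun _ e => e) := by
        rw [Finsupp.sum_fintype _ _ (fun _ => rfl), ← Finset.prod_pow_eq_pow_sum]
        exact Ideal.prod_mem_prod fun i _ => Ideal.pow_mem_pow (hzi i) _
      have h3 := Ideal.mul_mem_mul (Ideal.pow_mem_pow hy (r - α.sum fun _ e => e)) h2
      rwa [← pow_add, Nat.sub_add_cancel hle] at h3
  · rw [coe_eval₂Hom, eval₂_eq', map_sum, Finset.mul_sum]
    refine Finset.sum_congr rfl fun α hα => ?_
    have hle : (α.sum fun _ e => e) ≤ r := (le_totalDegree hα).trans hF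
    have h4 : ∏ i, ι (z i) ^ α i = ι y ^ (α.sum fun _ e => e) * ∏ i, t i ^ α i := by
      rw [Finsupp.sum_fintype _ _ (fun _ => rfl), ← Finset.prod_pow_eq_pow_sum,
        ← Finset.prod_mul_distrib]
      exact Finset.prod_congr rfl fun i _ => by rw [ht, mul_pow]
    simp only [map_mul, map_pow, map_prod]
    rw [h4, ← mul_assoc (ι y ^ _), ← pow_add, Nat.sub_add_cancel hle]
    ring

/-- The polynomial is the initial form of f with y set to 1. If it vanished, homogenizing would put
f in 𝔪 ^ (r + 1). -/
theorem exists_initial_form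
    (hψ : ∀ F, ψ (MvPolynomial.map (residue A) F) = Ideal.Quotient.mk _ (eval₂Hom ι t F)) [IsDomain B] (hz : maximalIdeal A = Ideal.span (insert y (Set.range z)))
    (ht : ∀ i, ι (z i) = ι y * t i) (hι : Function.Injective ι) (hy0 : ι y ≠ 0) {r : ℕ} {f : A}
    (hf : f ∈ maximalIdeal A ^ r) (hf' : f ∉ maximalIdeal A ^ (r + 1)) {b : B}
    (hb : ι f = ι y ^ r * b) :
    ∃ F, F ≠ 0 ∧ F.totalDegree ≤ r ∧ ψ F = Ideal.Quotient.mk _ b := by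
  obtain ⟨F, hF, hfF⟩ := exists_dehomogenization hz ht r f hf
  have hbF : b = eval₂Hom ι t F := mul_left_cancel₀ (pow_ne_zero r hy0) (hb.symm.trans hfF)
  refine ⟨MvPolynomial.map (residue A) F, fun h0 => hf' ?_, (Finset.sup_mono (support_map_subset _ _)).trans hF, by rw [hψ, hbF]⟩
  obtain ⟨g, hg, hgF⟩ := exists_homogenization hz ht hF h0
  rwa [hι (hfF.trans hgF.symm)]

theorem isPrime_span_of_chartMap_injective
    (hψ : ∀ F, ψ (MvPolynomial.map (residue A) F) = Ideal.Quotient.mk _ (eval₂Hom ι t F))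
    (hsurj : Function.Surjective (eval₂Hom ι t)) (hinj : Function.Injective ψ) :
    (Ideal.span {ι y}).IsPrime := by
  rw [← Ideal.Quotient.isDomain_iff_prime]
  exact (RingEquiv.ofBijective ψ ⟨hinj, chartMap_surjective hψ hsurj⟩).symm.toMulEquiv.isDomain _

theorem mul_notMem_span_of_initial_form
    (hψ : ∀ F, ψ (MvPolynomial.map (residue A) F) = Ideal.Quotient.mk _ (eval₂Hom ι t F))
    (hsurj : Function.Surjective (eval₂Hom ι t)) (hinj : Function.Injective ψ) {p : Ideal B} (hy : ι y ∈ p)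
    {s b : B} (hs : s ∉ p) {F : MvPolynomial (Fin n) (ResidueField A)} (hF : F ≠ 0)
    (hFb : ψ F = Ideal.Quotient.mk _ b) : s * b ∉ Ideal.span {ι y} := by
  intro h
  rcases (isPrime_span_of_chartMap_injective hψ hsurj hinj).mem_or_mem h with h | h
  · exact hs ((Ideal.span_singleton_le_iff_mem _).2 hy h)
  · rw [← Ideal.Quotient.eq_zero_iff_mem, ← hFb] at h
    exact hF (hinj (h.trans (map_zero ψ).symm))

/-- Modulo y, the prime p becomes a prime P of the polynomial ring and s * b becomes S * F with S
outside P. Membership in P ^ (r + 1) would contradict the degree bound on F. -/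
theorem mul_notMem_pow_of_initial_form
    (hψ : ∀ F, ψ (MvPolynomial.map (residue A) F) = Ideal.Quotient.mk _ (eval₂Hom ι t F))
    (hsurj : Function.Surjective (eval₂Hom ι t)) (hinj : Function.Injective ψ) {p : Ideal B} [p.IsPrime]
    (hy : ι y ∈ p) {s b : B} (hs : s ∉ p) {F : MvPolynomial (Fin n) (ResidueField A)} (hF : F ≠ 0)
    {r : ℕ} (hr : F.totalDegree ≤ r) (hFb : ψ F = Ideal.Quotient.mk _ b) :
    s * b ∉ p ^ (r + 1) := by
  intro h
  have hle : Ideal.span {ι y} ≤ p := (Ideal.span_singleton_le_iff_mem _).2 hy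
  have hψs := chartMap_surjective hψ hsurj
  let p' := p.map (Ideal.Quotient.mk (Ideal.span {ι y}))
  have hp' : p'.IsPrime := Ideal.isPrime_map_quotientMk_of_isPrime hle
  let P := p'.comap ψ
  have hmem : ∀ c, Ideal.Quotient.mk _ c ∈ p' ↔ c ∈ p := by
    intro c
    rw [← Ideal.mem_comap, Ideal.comap_map_of_surjective _ Ideal.Quotient.mk_surjective,
      ← RingHom.ker_eq_comap_bot, Ideal.mk_ker, sup_eq_left.2 hle]
  obtain ⟨S, hS⟩ := hψs (Ideal.Quotient.mk _ s)
  have hSP : S ∉ P := by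
    rw [Ideal.mem_comap, hS, hmem]; exact hs
  have h1 : ψ (S * F) ∈ p' ^ (r + 1) := by
    rw [map_mul, hS, hFb, ← map_mul, ← Ideal.map_pow]
    exact Ideal.mem_map_of_mem _ h
  have h2 : p' = P.map ψ := (Ideal.map_comap_of_surjective _ hψs _).symm
  rw [h2, ← Ideal.map_pow] at h1
  obtain ⟨G, hG, hGe⟩ := (Ideal.mem_map_iff_of_surjective ψ hψs).1 h1
  rw [hinj hGe] at hG
  have := MvPolynomial.le_totalDegree_of_mul_mem_pow hSP hG hF
  omega

/-- C / (y) consists of fractions of images of polynomials in n variables, so its maximal ideal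
needs at most n generators; y is one more. -/
theorem spanFinrank_maximalIdeal_chart_le
    (hψ : ∀ F, ψ (MvPolynomial.map (residue A) F) = Ideal.Quotient.mk _ (eval₂Hom ι t F))
    (hsurj : Function.Surjective (eval₂Hom ι t)) {p : Ideal B} [p.IsPrime] (hy : ι y ∈ p)
    {C : Type*} [CommRing C] [Algebra B C] [IsLocalRing C] [IsNoetherianRing C]
    [IsLocalization.AtPrime C p] : (maximalIdeal C).spanFinrank ≤ n + 1 := by
  let y' := algebraMap B C (ι y)
  have hy' : y' ∈ maximalIdeal C := (IsLocalization.AtPrime.to_map_mem_maximal_iff C p _).2 hy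
  have hne : Ideal.span {y'} ≠ ⊤ := fun h => by
    rw [Ideal.span_singleton_eq_top] at h; exact hy' h
  have : Nontrivial (C ⧸ Ideal.span {y'}) := Ideal.Quotient.nontrivial_iff.2 hne
  have : IsLocalRing (C ⧸ Ideal.span {y'}) :=
    IsLocalRing.of_surjective' _ Ideal.Quotient.mk_surjective
  let j : B ⧸ Ideal.span {ι y} →+* C ⧸ Ideal.span {y'} :=
    Ideal.quotientMap _ (algebraMap B C) (by
      rw [Ideal.span_singleton_le_iff_mem]
      exact Ideal.mem_span_singleton_self _)
  have hj : ∀ b, j (Ideal.Quotient.mk _ b) = Ideal.Quotient.mk _ (algebraMap B C b) := fun b =>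
    Ideal.quotientMap_mk
  have hψs := chartMap_surjective hψ hsurj
  have h1 := spanFinrank_maximalIdeal_le_of_fractions (n := n) (j.comp ψ) (by
    intro d
    obtain ⟨c, rfl⟩ := Ideal.Quotient.mk_surjective d
    obtain ⟨⟨b, s⟩, hbs⟩ := IsLocalization.surj p.primeCompl c
    obtain ⟨r, hr⟩ := hψs (Ideal.Quotient.mk _ b)
    obtain ⟨s', hs'⟩ := hψs (Ideal.Quotient.mk _ (s : B))
    refine ⟨r, s', ?_, ?_⟩
    · rw [RingHom.comp_apply, hs', hj]
      exact (IsLocalization.map_units C s).map _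
    · rw [RingHom.comp_apply, RingHom.comp_apply, hr, hs', hj, hj, ← map_mul, hbs]) (by
    have hprime := Ideal.comap_isPrime (j.comp ψ) (maximalIdeal (C ⧸ Ideal.span {y'}))
    have := Ideal.height_le_ringKrullDim_of_ne_top hprime.ne_top
    rw [ringKrullDim_mvPolynomial_field] at this
    exact_mod_cast this)
  exact spanFinrank_maximalIdeal_le_quotient_add_one.trans (Nat.succ_le_succ h1)

end Chart

/-! ### A single local quadratic transform -/

/-- The properties of a local quadratic transform `C` of the regular local ring `A`, with respect to
an element `y` generating the extension of the maximal ideal of `A`. -/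
structure QuadStep {K : Type*} [Field K] (A C : LocalSubring K) (y : K) : Prop where
  mem : y ∈ A.maxPow 1
  notMem : y ∉ A.maxPow 2
  le : A.toSubring ≤ C.toSubring
  mem_target : y ∈ C.maxPow 1
  div_mem : ∀ a ∈ A.maxPow 1, a / y ∈ C.toSubring
  frac : ∀ c ∈ C.toSubring, ∃ a ∈ A.toSubring, ∃ s ∈ A.toSubring, ∃ k : ℕ, s ≠ 0 ∧
    s / y ^ k ∈ C.toSubring ∧ (s / y ^ k)⁻¹ ∈ C.toSubring ∧ c = a / s
  chart_frac : ∀ (hy : y ∈ A.toSubring), ∀ c ∈ C.toSubring, ∃ a ∈ blowupChart A ⟨y, hy⟩,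
    ∃ s ∈ blowupChart A ⟨y, hy⟩, s ≠ 0 ∧ s⁻¹ ∈ C.toSubring ∧ c = a / s
  isPrime : ∀ hy : y ∈ C.toSubring, (Ideal.span {(⟨y, hy⟩ : C.toSubring)}).IsPrime
  div_notMem : ∀ (r : ℕ) (f : K), f ∈ A.maxPow r → f ∉ A.maxPow (r + 1) →
    f / y ^ (r + 1) ∉ C.toSubring
  div_notMem_maxPow : ∀ (r : ℕ) (f : K), f ∈ A.maxPow r → f ∉ A.maxPow (r + 1) →
    f / y ^ r ∉ C.maxPow (r + 1)

namespace LocalSubring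

variable {K : Type*} [Field K]

theorem div_mem_blowupChart {A : LocalSubring K} {y : A.toSubring} {a : K} (ha : a ∈ A.maxPow 1) :
    a / y ∈ blowupChart A y :=
  Subring.subset_closure (Or.inr ⟨⟨a, ha.1⟩, coe_mem_maxPow_one.1 ha, rfl⟩)

theorem exists_eq_div_pow_of_mem_blowupChart {A : LocalSubring K} {y : A.toSubring}
    (hy0 : (y : K) ≠ 0) {b : K} (hb : b ∈ blowupChart A y) :
    ∃ (k : ℕ) (a : K), a ∈ A.toSubring ∧ b = a / (y : K) ^ k := by
  induction hb using Subring.closure_induction with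
  | mem x hx =>
    rcases hx with hx | ⟨a, _, rfl⟩
    · exact ⟨0, x, hx, by simp⟩
    · exact ⟨1, a, a.2, by simp⟩
  | zero => exact ⟨0, 0, zero_mem _, by simp⟩
  | one => exact ⟨0, 1, one_mem _, by simp⟩
  | add b c _ _ hb hc =>
    obtain ⟨k, a, ha, rfl⟩ := hb
    obtain ⟨l, d, hd, rfl⟩ := hc
    refine ⟨k + l, a * y ^ l + d * y ^ k, add_mem (mul_mem ha (pow_mem y.2 _))
      (mul_mem hd (pow_mem y.2 _)), ?_⟩
    field_simp
    ring
  | neg b _ hb =>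
    obtain ⟨k, a, ha, rfl⟩ := hb
    exact ⟨k, -a, neg_mem ha, by ring⟩
  | mul b c _ _ hb hc =>
    obtain ⟨k, a, ha, rfl⟩ := hb
    obtain ⟨l, d, hd, rfl⟩ := hc
    exact ⟨k + l, a * d, mul_mem ha hd, by rw [pow_add]; field_simp⟩

/-- A criterion for being a local quadratic transform. -/
theorem isLocalQuadraticTransform_of_frac {A C : LocalSubring K} {y : K} (hy : y ∈ A.maxPow 1)
    (hy2 : y ∉ A.maxPow 2) (hle : blowupChart A ⟨y, hy.1⟩ ≤ C.toSubring)
    (hdom : ∀ a ∈ A.maxPow 1, a ∈ C.maxPow 1)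
    (hfrac : ∀ c ∈ C.toSubring, ∃ a ∈ blowupChart A ⟨y, hy.1⟩,
      ∃ s ∈ blowupChart A ⟨y, hy.1⟩, s ≠ 0 ∧ s⁻¹ ∈ C.toSubring ∧ c = a / s) :
    IsLocalQuadraticTransform A C := by
  refine ⟨⟨y, hy.1⟩, coe_mem_maxPow_one.1 hy, fun h => hy2 (coe_mem_maxPow.2 h),
    ⟨C.center hle, inferInstance⟩, fun a ha => ?_, (ofPrime_center_eq hle hfrac).symm⟩
  rw [Ideal.mem_comap, mem_center]
  exact hdom a (coe_mem_maxPow_one.2 ha)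

-- C is regular because its embedding dimension is at most n + 1, its dimension. The two statements
-- on orders hold because f / y ^ r reduces modulo y to a nonzero polynomial of degree at most r.
open MvPolynomial in
theorem exists_quadStep {A C : LocalSubring K} [IsRegularLocalRing A.toSubring] {n : ℕ}
    (hA : ringKrullDim A.toSubring = (n + 1 : ℕ)) (hC : ringKrullDim C.toSubring = (n + 1 : ℕ))
    (h : IsLocalQuadraticTransform A C) :
    IsRegularLocalRing C.toSubring ∧ ∃ y, QuadStep A C y := by
  obtain ⟨y, hy, hy2, ⟨p, hpp⟩, hp, rfl⟩ := h
  dsimp only at hp hC ⊢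
  let B := blowupChart A y
  let ι : A.toSubring →+* B := Subring.inclusion (le_blowupChart A y)
  have hs : (maximalIdeal A.toSubring).spanFinrank = n + 1 := by
    have := IsRegularLocalRing.spanFinrank_maximalIdeal (R := A.toSubring)
    rw [hA] at this
    exact_mod_cast this
  obtain ⟨z, hz⟩ := exists_generators_insert hs hy hy2
  have hy0 : (y : K) ≠ 0 := fun h0 => hy2 (by
    have : y = 0 := Subtype.ext h0
    rw [this]; exact Ideal.zero_mem _)
  have hzm : ∀ i, z i ∈ maximalIdeal A.toSubring := fun i =>
    hz ▸ Ideal.subset_span (Set.mem_insert_of_mem _ ⟨i, rfl⟩)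
  let t : Fin n → B := fun i => ⟨z i / y, div_mem_blowupChart (coe_mem_maxPow_one.2 (hzm i))⟩
  have ht : ∀ i, ι (z i) = ι y * t i := fun i => Subtype.ext (by
    change (z i : K) = y * (z i / y); field_simp)
  have hsurj : Function.Surjective (eval₂Hom ι t) := by
    have hrange : B ≤ ((eval₂Hom ι t).range).map B.subtype := by
      refine Subring.closure_le.2 ?_
      rintro x (hx | ⟨a, ha, rfl⟩)
      · exact ⟨ι ⟨x, hx⟩, ⟨C ⟨x, hx⟩, eval₂Hom_C _ _ _⟩, rfl⟩
      · obtain ⟨F, _, hF⟩ := exists_dehomogenization hz ht 1 a (by rwa [pow_one])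
        refine ⟨_, ⟨F, rfl⟩, ?_⟩
        have h1 : (a : K) = (y : K) ^ 1 * (eval₂Hom ι t F : B) := congrArg Subtype.val hF
        change ((eval₂Hom ι t F : B) : K) = _
        rw [h1]; field_simp
    intro b
    obtain ⟨b', ⟨F, hF⟩, hb⟩ := hrange b.2
    exact ⟨F, hF.trans (Subtype.ext hb)⟩
  have hnoeth : IsNoetherianRing B := isNoetherianRing_of_surjective _ _ (eval₂Hom ι t) hsurj
  have hyp : ι y ∈ p := hp hy
  have hheight : (n + 1 : ℕ) ≤ p.height := by
    rw [ringKrullDim_ofPrime] at hC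
    exact le_of_eq (WithBot.coe_injective hC).symm
  obtain ⟨ψ, hψ⟩ := exists_chartMap hz ht
  have hinj := chartMap_injective hψ hsurj hyp hheight
  have hCn := isNoetherianRing_ofPrime p
  have hιinj : Function.Injective ι := Subring.inclusion_injective _
  have hιy0 : ι y ≠ 0 := fun h => hy0 (congrArg Subtype.val h)
  have hBC : B ≤ (ofPrime B p).toSubring := le_ofPrime B p
  have hprime := isPrime_span_of_chartMap_injective hψ hsurj hinj
  have hpow : ∀ r : ℕ, ∀ b ∈ (ofPrime B p).maxPow r, ∃ a : B, a ∈ p ^ r ∧ ∃ s : B, s ∉ p ∧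
      b = a / s := by
    rintro r b ⟨hb, hbr⟩
    rw [← IsLocalization.AtPrime.map_eq_maximalIdeal p (ofPrime B p).toSubring, ← Ideal.map_pow,
      IsLocalization.mem_map_algebraMap_iff p.primeCompl] at hbr
    obtain ⟨⟨a, s⟩, has⟩ := hbr
    refine ⟨a, a.2, s, s.2, ?_⟩
    have h1 : b * (s : B) = (a : B) := congrArg Subtype.val has
    have h2 := coe_ne_zero_of_not_mem s.2
    rw [← h1]; field_simp
  have hform : ∀ (r : ℕ) (f : K), f ∈ A.maxPow r → f ∉ A.maxPow (r + 1) →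
      ∃ (b : B) (F : MvPolynomial (Fin n) (ResidueField A.toSubring)), f = (y : K) ^ r * b ∧
        F ≠ 0 ∧ F.totalDegree ≤ r ∧ ψ F = Ideal.Quotient.mk _ b := by
    rintro r f ⟨hfA, hf⟩ hf'
    obtain ⟨F, hF, hfF⟩ := exists_dehomogenization hz ht r _ hf
    obtain ⟨G, hG, hGr, hGb⟩ := exists_initial_form hψ hz ht hιinj hιy0 hf
      (fun h => hf' (coe_mem_maxPow.2 h)) hfF
    exact ⟨_, G, congrArg Subtype.val hfF, hG, hGr, hGb⟩
  refine ⟨.of_spanFinrank_maximalIdeal_le _ ?_, y, ?_⟩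
  · rw [hC]
    have := spanFinrank_maximalIdeal_chart_le hψ hsurj hyp (C := (ofPrime B p).toSubring)
    exact_mod_cast this
  · refine ⟨coe_mem_maxPow_one.2 hy, fun h => hy2 (coe_mem_maxPow.1 h),
      (le_blowupChart A y).trans hBC, mem_maxPow_ofPrime.2 hyp, fun a ha =>
      hBC (div_mem_blowupChart ha), ?_, ?_, ?_, ?_, ?_⟩
    · intro c hc
      obtain ⟨a, s, hs, rfl⟩ := mem_ofPrime.1 hc
      have hs0 := coe_ne_zero_of_not_mem hs
      obtain ⟨k, a', ha', ha⟩ := exists_eq_div_pow_of_mem_blowupChart hy0 a.2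
      obtain ⟨l, s', hs', hs1⟩ := exists_eq_div_pow_of_mem_blowupChart hy0 s.2
      have hs'0 : s' ≠ 0 := fun h0 => hs0 (by rw [hs1, h0, zero_div])
      have hs2 : s' * (y : K) ^ k / (y : K) ^ (l + k) = s := by
        rw [hs1, pow_add]; field_simp
      refine ⟨a' * y ^ l, mul_mem ha' (pow_mem y.2 _), s' * y ^ k, mul_mem hs' (pow_mem y.2 _),
        l + k, mul_ne_zero hs'0 (pow_ne_zero _ hy0), ?_, ?_, ?_⟩
      · rw [hs2]; exact hBC s.2
      · rw [hs2]; exact inv_mem (hBC s.2) (by rwa [mem_maxPow_ofPrime])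
      · rw [ha, hs1]; field_simp
    · intro _ c hc
      obtain ⟨a, s, hs, rfl⟩ := mem_ofPrime.1 hc
      exact ⟨a, a.2, s, s.2, coe_ne_zero_of_not_mem hs, inv_mem (hBC s.2)
        (by rwa [mem_maxPow_ofPrime]), rfl⟩
    · intro hyC
      have h1 := IsLocalization.isPrime_of_isPrime_disjoint p.primeCompl (ofPrime B p).toSubring
        (Ideal.span {ι y}) hprime (by
          rw [Set.disjoint_left]
          intro a ha ha'
          exact ha ((Ideal.span_singleton_le_iff_mem _).2 hyp ha'))
      rw [Ideal.map_span, Set.image_singleton] at h1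
      exact h1
    · intro r f hf hf' hcon
      obtain ⟨b, F, hb, hF, hFr, hFb⟩ := hform r f hf hf'
      obtain ⟨a, s, hs, has⟩ := mem_ofPrime.1 hcon
      have hs0 := coe_ne_zero_of_not_mem hs
      refine mul_notMem_span_of_initial_form hψ hsurj hinj hyp hs hF hFb
        (Ideal.mem_span_singleton.2 ⟨a, Subtype.ext ?_⟩)
      change (s : K) * b = y * a
      rw [hb, pow_succ] at has
      field_simp at has
      rw [mul_comm, has]
    · intro r f hf hf' hcon
      obtain ⟨b, F, hb, hF, hFr, hFb⟩ := hform r f hf hf'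
      obtain ⟨a, ha, s, hs, has⟩ := hpow _ _ hcon
      have hs0 := coe_ne_zero_of_not_mem hs
      refine mul_notMem_pow_of_initial_form hψ hsurj hinj hyp hs hF hFr hFb ?_
      have : s * b = a := by
        apply Subtype.ext
        change (s : K) * b = a
        rw [hb, mul_div_cancel_left₀ _ (pow_ne_zero _ hy0)] at has
        rw [has]; field_simp
      rwa [this]

end LocalSubring

/-! ### Sequences of local quadratic transforms -/

section Sequence

open LocalSubring

variable {K : Type*} [Field K]

theorem Ideal.eq_of_le_of_height_eq_one {R : Type*} [CommRing R] [IsDomain R] {p q : Ideal R}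
    [p.IsPrime] [q.IsPrime] (hq : q.height = 1) (hle : p ≤ q) (hp : p ≠ ⊥) : p = q := by
  by_contra hne
  have h1 := Ideal.height_add_one_le_of_lt_of_isPrime (lt_of_le_of_ne hle hne)
  rw [hq] at h1
  have h2 : p.height = 0 := by
    by_contra h0
    have : (1 : ℕ∞) ≤ p.height := Order.one_le_iff_ne_zero.2 h0
    have h3 := (add_le_add_left this 1).trans h1
    exact absurd h3 (by decide)
  exact hp (Ideal.height_eq_zero_iff_eq_bot.1 h2)

namespace QuadStep

variable {A C : LocalSubring K} {y : K}

theorem ne_zero (h : QuadStep A C y) : y ≠ 0 := ne_zero_of_not_mem h.notMem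

theorem mem_maxPow_one (h : QuadStep A C y) {a : K} (ha : a ∈ A.maxPow 1) : a ∈ C.maxPow 1 := by
  rw [← div_mul_cancel₀ a h.ne_zero]
  exact mul_mem_maxPow_left (h.div_mem a ha) h.mem_target

theorem div_pow_mem (h : QuadStep A C y) (r : ℕ) {a : K} (ha : a ∈ A.maxPow r) :
    a / y ^ r ∈ C.toSubring := by
  obtain ⟨haA, ha⟩ := ha
  suffices hs : ∀ r : ℕ, ∀ a ∈ maximalIdeal A.toSubring ^ r, (a : K) / y ^ r ∈ C.toSubring from
    hs r _ ha
  intro r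
  induction r with
  | zero => intro a _; simpa using h.le a.2
  | succ r ih =>
    intro a ha
    rw [pow_succ] at ha
    refine Submodule.mul_induction_on ha (fun a ha b hb => ?_) (fun a b ha hb => ?_)
    · have := mul_mem (ih a ha) (h.div_mem b (coe_mem_maxPow_one.2 hb))
      convert this using 1
      push_cast
      rw [pow_succ]; field_simp
    · have := add_mem ha hb
      convert this using 1
      push_cast
      rw [add_div]

/-- Away from y = 0 the blow-up changes nothing: denominators of elements of C over A are units of C
times powers of y. -/
theorem ofPrime_center_eq (h : QuadStep A C y) (q : Ideal C.toSubring) [q.IsPrime]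
    (hy : y ∉ (ofPrime C.toSubring q).maxPow 1) :
    ofPrime A.toSubring ((ofPrime C.toSubring q).center (h.le.trans (le_ofPrime _ q))) =
      ofPrime C.toSubring q := by
  apply LocalSubring.ofPrime_center_eq
  have hW := le_ofPrime C.toSubring q
  have hyi := inv_mem (hW h.mem_target.1) hy
  have key : ∀ c ∈ C.toSubring, ∃ a ∈ A.toSubring, ∃ s ∈ A.toSubring, s ≠ 0 ∧
      s⁻¹ ∈ (ofPrime C.toSubring q).toSubring ∧ c = a / s := by
    intro c hc
    obtain ⟨a, ha, s, hs, k, hs0, hsk, hski, rfl⟩ := h.frac c hc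
    refine ⟨a, ha, s, hs, hs0, ?_, rfl⟩
    have := mul_mem (hW hski) (pow_mem hyi k)
    convert this using 1
    have := h.ne_zero
    rw [inv_pow]
    field_simp
  intro c hc
  obtain ⟨a, s, hs, rfl⟩ := mem_ofPrime.1 hc
  have hs0 := coe_ne_zero_of_not_mem hs
  obtain ⟨a1, ha1, s1, hs1, hs10, hs1i, ea⟩ := key a a.2
  obtain ⟨a2, ha2, s2, hs2, hs20, hs2i, es⟩ := key s s.2
  have ha20 : a2 ≠ 0 := fun h0 => hs0 (by rw [es, h0, zero_div])
  refine ⟨a1 * s2, mul_mem ha1 hs2, s1 * a2, mul_mem hs1 ha2, mul_ne_zero hs10 ha20, ?_, ?_⟩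
  · have h1 : (s : K)⁻¹ ∈ (ofPrime C.toSubring q).toSubring :=
      inv_mem (hW s.2) (by rwa [mem_maxPow_ofPrime])
    have := mul_mem hs1i (mul_mem h1 hs2i)
    convert this using 1
    rw [es]; field_simp
  · rw [ea, es]; field_simp

end QuadStep

/-- A sequence of regular local rings of dimension `d` and local quadratic transforms, with a choice
of generators `y n` of the extensions of the maximal ideals. -/
structure QuadChain (d : ℕ) (R : ℕ → LocalSubring K) (y : ℕ → K) : Prop where
  regular : ∀ n, IsRegularLocalRing (R n).toSubring
  dim : ∀ n, ringKrullDim (R n).toSubring = d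
  step : ∀ n, QuadStep (R n) (R (n + 1)) (y n)

theorem IsQuadraticSequence.exists_quadChain {d : ℕ} (hd : 1 ≤ d) {R : ℕ → LocalSubring K}
    (hR : IsQuadraticSequence d R) : ∃ y, QuadChain d R y := by
  obtain ⟨n, rfl⟩ := Nat.exists_eq_add_of_le' hd
  have hreg : ∀ k, IsRegularLocalRing (R k).toSubring := by
    intro k
    induction k with
    | zero => exact hR.regular_zero
    | succ k ih => exact (exists_quadStep (hR.dim_eq k) (hR.dim_eq (k + 1)) (hR.transform k)).1
  choose y hy using fun k =>
    have := hreg k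
    (exists_quadStep (hR.dim_eq k) (hR.dim_eq (k + 1)) (hR.transform k)).2
  exact ⟨y, hreg, hR.dim_eq, hy⟩

namespace QuadChain

variable {d : ℕ} {R : ℕ → LocalSubring K} {y : ℕ → K}

theorem monotone (hR : QuadChain d R y) : Monotone fun n => (R n).toSubring :=
  monotone_nat_of_le_succ fun n => (hR.step n).le

theorem mem_seqUnion (hR : QuadChain d R y) {a : K} :
    a ∈ seqUnion R ↔ ∃ n, a ∈ (R n).toSubring :=
  Subring.mem_iSup_of_directed hR.monotone.directed_le

theorem mem_maxPow_one (hR : QuadChain d R y) {m n : ℕ} (h : m ≤ n) {a : K}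
    (ha : a ∈ (R m).maxPow 1) : a ∈ (R n).maxPow 1 := by
  induction n, h using Nat.le_induction with
  | base => exact ha
  | succ n _ ih => exact (hR.step n).mem_maxPow_one ih

theorem inv_notMem_seqUnion (hR : QuadChain d R y) {m : ℕ} {a : K} (ha : a ∈ (R m).maxPow 1)
    (ha0 : a ≠ 0) : a⁻¹ ∉ seqUnion R := by
  rw [hR.mem_seqUnion]
  rintro ⟨n, hn⟩
  exact not_mem_maxPow_one ha0 (hR.monotone (le_max_right m n) hn)
    (hR.mem_maxPow_one (le_max_left m n) ha)

theorem shift (hR : QuadChain d R y) (M : ℕ) :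
    QuadChain d (fun n => R (M + n)) (fun n => y (M + n)) :=
  ⟨fun _ => hR.regular _, fun _ => hR.dim _, fun _ => hR.step _⟩

theorem seqUnion_shift (hR : QuadChain d R y) (M : ℕ) :
    seqUnion (fun n => R (M + n)) = seqUnion R := by
  ext a
  rw [(hR.shift M).mem_seqUnion, hR.mem_seqUnion]
  exact ⟨fun ⟨n, h⟩ => ⟨_, h⟩, fun ⟨n, h⟩ => ⟨n, hR.monotone (Nat.le_add_left n M) h⟩⟩

/-- An element whose successive transforms have constant positive order lies in the center of a
localization at a height one prime that contains the union of the sequence. -/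
theorem exists_height_one_of_constant_order (hR : QuadChain d R y) {r : ℕ} (hr : 1 ≤ r) {h : ℕ → K}
    (hmem : ∀ n, h n ∈ (R n).maxPow r) (hnot : ∀ n, h n ∉ (R n).maxPow (r + 1))
    (hsucc : ∀ n, h (n + 1) = h n / y n ^ r) :
    ∃ q : PrimeSpectrum (R 0).toSubring, q.asIdeal.height = 1 ∧
      h 0 ∈ (ofPrime (R 0).toSubring q.asIdeal).maxPow 1 ∧
      seqUnion R ≤ (ofPrime (R 0).toSubring q.asIdeal).toSubring := by
  have h0 : ∀ n, h n ≠ 0 := fun n => ne_zero_of_not_mem (hnot n)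
  -- The components of h n = 0, recorded as subrings of K so that they can be compared for different
  -- n.
  let F : ℕ → Set (LocalSubring K) := fun n => {W | ∃ q : PrimeSpectrum (R n).toSubring,
    W = ofPrime (R n).toSubring q.asIdeal ∧ q.asIdeal.height = 1 ∧ h n ∈ W.maxPow 1}
  have hfin : ∀ n, (F n).Finite := by
    intro n
    have := hR.regular n
    have h1 := Ideal.finite_minimalPrimes_of_isNoetherianRing (R n).toSubring
      (Ideal.span {(⟨h n, (hmem n).1⟩ : (R n).toSubring)})
    have h2 : {q : PrimeSpectrum (R n).toSubring | q.asIdeal ∈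
        (Ideal.span {(⟨h n, (hmem n).1⟩ : (R n).toSubring)}).minimalPrimes}.Finite :=
      h1.preimage (fun a _ b _ hab => PrimeSpectrum.ext hab)
    refine (h2.image fun q => ofPrime (R n).toSubring q.asIdeal).subset ?_
    rintro W ⟨q, rfl, hq, hqm⟩
    refine ⟨q, ?_, rfl⟩
    have hmq : (⟨h n, (hmem n).1⟩ : (R n).toSubring) ∈ q.asIdeal := by
      rwa [← mem_maxPow_ofPrime]
    refine ⟨⟨q.2, (Ideal.span_singleton_le_iff_mem _).2 hmq⟩, ?_⟩
    rintro p ⟨hp, hpm⟩ hpq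
    rw [Ideal.eq_of_le_of_height_eq_one hq hpq]
    rintro rfl
    rw [le_bot_iff, Ideal.span_singleton_eq_bot] at hpm
    exact h0 n (congrArg Subtype.val hpm)
  have hne : ∀ n, (F n).Nonempty := by
    intro n
    have := hR.regular n
    have hm : (⟨h n, (hmem n).1⟩ : (R n).toSubring) ∈ maximalIdeal (R n).toSubring := by
      rw [← coe_mem_maxPow_one]
      exact maxPow_anti hr (hmem n)
    obtain ⟨p, hp, -⟩ := Ideal.exists_minimalPrimes_le
      ((Ideal.span_singleton_le_iff_mem _).2 hm)
    have hpp : p.IsPrime := hp.1.1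
    have hmp : (⟨h n, (hmem n).1⟩ : (R n).toSubring) ∈ p :=
      (Ideal.span_singleton_le_iff_mem _).1 hp.1.2
    refine ⟨_, ⟨p, hpp⟩, rfl, ?_, mem_maxPow_ofPrime.2 hmp⟩
    refine le_antisymm ?_ (Order.one_le_iff_ne_zero.2 ?_)
    · have : (Ideal.span {(⟨h n, (hmem n).1⟩ : (R n).toSubring)}).IsPrincipal := ⟨_, rfl⟩
      exact Ideal.height_le_one_of_isPrincipal_of_mem_minimalPrimes _ p hp
    · dsimp only
      rw [Ne, Ideal.height_eq_zero_iff_eq_bot]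
      rintro rfl
      exact h0 n (congrArg Subtype.val (Ideal.mem_bot.1 hmp))
  -- No component of h (n + 1) is the exceptional one, since y n does not divide h (n + 1); so each
  -- is already a localization of R n, at a component of h n.
  have hsub : ∀ n, F (n + 1) ⊆ F n := by
    rintro n W ⟨q, rfl, hq, hqm⟩
    have hstep := hR.step n
    have hyq : y n ∉ (ofPrime (R (n + 1)).toSubring q.asIdeal).maxPow 1 := by
      intro hyq
      have hyC := hstep.mem_target.1
      have hyq' : (⟨y n, hyC⟩ : (R (n + 1)).toSubring) ∈ q.asIdeal := by
        rwa [← mem_maxPow_ofPrime]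
      have hp := hstep.isPrime hyC
      have heq := Ideal.eq_of_le_of_height_eq_one hq
        ((Ideal.span_singleton_le_iff_mem _).2 hyq') (by
          rw [Ne, Ideal.span_singleton_eq_bot]
          exact fun h => hstep.ne_zero (congrArg Subtype.val h))
      have hmq : (⟨h (n + 1), (hmem (n + 1)).1⟩ : (R (n + 1)).toSubring) ∈ q.asIdeal := by
        rwa [← mem_maxPow_ofPrime]
      rw [← heq, Ideal.mem_span_singleton] at hmq
      obtain ⟨c, hc⟩ := hmq
      have hc' : h (n + 1) = y n * c := congrArg Subtype.val hc
      apply hstep.div_notMem r (h n) (hmem n) (hnot n)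
      have := hstep.ne_zero
      rw [pow_succ, ← div_div, ← hsucc, hc', mul_div_cancel_left₀ _ this]
      exact c.2
    have hW := hstep.ofPrime_center_eq q.asIdeal hyq
    refine ⟨⟨_, center_isPrime _ _⟩, hW.symm, ?_, ?_⟩
    · have h1 := congrArg (fun W : LocalSubring K => ringKrullDim W.toSubring) hW
      simp only [ringKrullDim_ofPrime] at h1
      exact (WithBot.coe_injective h1).trans hq
    · have : h n = h (n + 1) * y n ^ r := by
        rw [hsucc, div_mul_cancel₀ _ (pow_ne_zero _ hstep.ne_zero)]
      rw [this]
      exact mul_mem_maxPow_right hqm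
        (pow_mem (le_ofPrime _ _ hstep.mem_target.1) _)
  have hanti : Antitone F := antitone_nat_of_succ_le hsub
  -- A decreasing sequence of nonempty finite sets is constant from the least cardinality on.
  obtain ⟨N, hN⟩ : ∃ N, ∀ n, (F N).ncard ≤ (F n).ncard := by
    obtain ⟨m, ⟨N, rfl⟩, hN⟩ := WellFounded.has_min (wellFounded_lt (α := ℕ))
      (Set.range fun n => (F n).ncard) ⟨_, 0, rfl⟩
    exact ⟨N, fun n => not_lt.1 (hN _ ⟨n, rfl⟩)⟩
  obtain ⟨W, hW⟩ := hne N
  have hWall : ∀ n, W ∈ F n := by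
    intro n
    rcases le_total n N with h | h
    · exact hanti h hW
    · rw [Set.eq_of_subset_of_ncard_le (hanti h) (hN n) (hfin N)]
      exact hW
  obtain ⟨q, rfl, hq, hqm⟩ := hWall 0
  refine ⟨q, hq, hqm, fun a ha => ?_⟩
  obtain ⟨n, hn⟩ := hR.mem_seqUnion.1 ha
  obtain ⟨q', hq', -⟩ := hWall n
  rw [hq']
  exact le_ofPrime _ _ hn

theorem exists_pair_order {A : LocalSubring K} {a b : K} (ha : a ∈ A.toSubring)
    (hb : b ∈ A.toSubring) {r : ℕ} (h : a ∉ A.maxPow (r + 1) ∨ b ∉ A.maxPow (r + 1)) :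
    ∃ s ≤ r, a ∈ A.maxPow s ∧ b ∈ A.maxPow s ∧ (a ∉ A.maxPow (s + 1) ∨ b ∉ A.maxPow (s + 1)) := by
  classical
  have hex : ∃ s, a ∉ A.maxPow (s + 1) ∨ b ∉ A.maxPow (s + 1) := ⟨r, h⟩
  refine ⟨Nat.find hex, Nat.find_min' hex h, ?_⟩
  have hspec := Nat.find_spec hex
  rcases hs : Nat.find hex with _ | s
  · exact ⟨mem_maxPow_zero.2 ha, mem_maxPow_zero.2 hb, hs ▸ hspec⟩
  · have := Nat.find_min hex (m := s) (by omega)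
    push Not at this
    exact ⟨this.1, this.2, hs ▸ hspec⟩

/-- If neither of `f, g` divides the other in the union of the sequence, there is a pair `a, b` with
the same ratio in some `R M`, whose order `r` is minimal among all such pairs, so that all
elements of order `r` of the ideal `(a, b)` have transforms of constant order. -/
theorem exists_minimal_pair (hR : QuadChain d R y) {f g : K} (hf : f ∈ seqUnion R)
    (hg : g ∈ seqUnion R) (hf0 : f ≠ 0) (hg0 : g ≠ 0) (hfg : f / g ∉ seqUnion R)
    (hgf : g / f ∉ seqUnion R) :
    ∃ (M r : ℕ) (a b : K), a ∈ (R M).maxPow r ∧ b ∈ (R M).maxPow r ∧ a ≠ 0 ∧ b ≠ 0 ∧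
      (a ∉ (R M).maxPow (r + 1) ∨ b ∉ (R M).maxPow (r + 1)) ∧
      (∀ c, c ≠ 0 → a / c ∈ (R M).toSubring → b / c ∈ (R M).toSubring → ∀ s,
        (a / c ∉ (R M).maxPow (s + 1) ∨ b / c ∉ (R M).maxPow (s + 1)) → r ≤ s) ∧
      ∀ u ∈ (R M).toSubring, ∀ v ∈ (R M).toSubring, u * a + v * b ∉ (R M).maxPow (r + 1) →
        ∃ q : PrimeSpectrum (R M).toSubring, q.asIdeal.height = 1 ∧
          u * a + v * b ∈ (ofPrime (R M).toSubring q.asIdeal).maxPow 1 ∧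
          seqUnion R ≤ (ofPrime (R M).toSubring q.asIdeal).toSubring := by
  classical
  -- With r quantified first, `Nat.find` minimizes the order over all stages M and all pairs of
  -- ratio f / g.
  have hex : ∃ (r M : ℕ) (a b : K), a ∈ (R M).maxPow r ∧ b ∈ (R M).maxPow r ∧ a ≠ 0 ∧ b ≠ 0 ∧
      a / b = f / g ∧ (a ∉ (R M).maxPow (r + 1) ∨ b ∉ (R M).maxPow (r + 1)) := by
    obtain ⟨m, hm⟩ := hR.mem_seqUnion.1 hf
    obtain ⟨n, hn⟩ := hR.mem_seqUnion.1 hg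
    have hm' := hR.monotone (le_max_left m n) hm
    have hn' := hR.monotone (le_max_right m n) hn
    have := hR.regular (max m n)
    obtain ⟨r, _, hr⟩ := exists_order hm' hf0
    obtain ⟨s, _, h1, h2, h3⟩ := exists_pair_order hm' hn' (Or.inl hr)
    exact ⟨s, max m n, f, g, h1, h2, hf0, hg0, rfl, h3⟩
  obtain ⟨M, a, b, ha, hb, ha0, hb0, hab, hnot⟩ := Nat.find_spec hex
  have hmin : ∀ (s M : ℕ) (a b : K), a ∈ (R M).toSubring → b ∈ (R M).toSubring → a ≠ 0 → b ≠ 0 →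
      a / b = f / g → (a ∉ (R M).maxPow (s + 1) ∨ b ∉ (R M).maxPow (s + 1)) →
      Nat.find hex ≤ s := by
    intro s M a b ha hb ha0 hb0 hab h
    obtain ⟨t, hts, h1, h2, h3⟩ := exists_pair_order ha hb h
    exact (Nat.find_min' hex ⟨M, a, b, h1, h2, ha0, hb0, hab, h3⟩).trans hts
  generalize Nat.find hex = r at *
  -- At order 0, a or b is a unit of R M, and then g / f or f / g lies in the union.
  have hr : 1 ≤ r := by
    by_contra! hr0
    obtain rfl : r = 0 := by omega
    rw [zero_add] at hnot
    rcases hnot with h | h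
    · apply hgf
      rw [← inv_div, ← hab, inv_div, div_eq_mul_inv]
      exact le_seqUnion R M (mul_mem hb.1 (inv_mem ha.1 h))
    · apply hfg
      rw [← hab, div_eq_mul_inv]
      exact le_seqUnion R M (mul_mem ha.1 (inv_mem hb.1 h))
  refine ⟨M, r, a, b, ha, hb, ha0, hb0, hnot, ?_, ?_⟩
  · intro c hc hac hbc s hs
    refine hmin s M _ _ hac hbc (div_ne_zero ha0 hc) (div_ne_zero hb0 hc) ?_ hs
    rw [← hab]; field_simp
  · intro u hu v hv huv
    let Y : ℕ → K := fun n => ∏ i ∈ Finset.range n, y (M + i) ^ r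
    have hY0 : ∀ n, Y n ≠ 0 := fun n => Finset.prod_ne_zero_iff.2 fun i _ =>
      pow_ne_zero _ (hR.step _).ne_zero
    have hYs : ∀ n c, c / Y (n + 1) = c / Y n / y (M + n) ^ r := fun n c => by
      rw [div_div]
      exact congrArg (fun t => c / t) (Finset.prod_range_succ _ _)
    -- The order of the pair cannot rise under a transform, and by minimality of r it cannot fall.
    have hall : ∀ n, a / Y n ∈ (R (M + n)).maxPow r ∧ b / Y n ∈ (R (M + n)).maxPow r ∧
        (a / Y n ∉ (R (M + n)).maxPow (r + 1) ∨ b / Y n ∉ (R (M + n)).maxPow (r + 1)) := by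
      intro n
      induction n with
      | zero => simpa [Y] using ⟨ha, hb, hnot⟩
      | succ n ih =>
        obtain ⟨h1, h2, h3⟩ := ih
        have hst := hR.step (M + n)
        have e1 := hst.div_pow_mem r h1
        have e2 := hst.div_pow_mem r h2
        have e3 := h3.imp (hst.div_notMem_maxPow r _ h1) (hst.div_notMem_maxPow r _ h2)
        rw [← hYs] at e1 e2
        rw [← hYs, ← hYs] at e3
        obtain ⟨s, hs, g1, g2, g3⟩ := exists_pair_order e1 e2 e3
        have hrs := hmin s (M + n + 1) _ _ e1 e2 (div_ne_zero ha0 (hY0 _))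
          (div_ne_zero hb0 (hY0 _)) (by rw [← hab]; have := hY0 (n + 1); field_simp) g3
        obtain rfl : s = r := le_antisymm hs hrs
        exact ⟨g1, g2, e3⟩
    have hle : ∀ n, (R M).toSubring ≤ (R (M + n)).toSubring := fun n =>
      hR.monotone (Nat.le_add_right M n)
    have hmem : ∀ n, (u * a + v * b) / Y n ∈ (R (M + n)).maxPow r := by
      intro n
      rw [add_div, mul_div_assoc, mul_div_assoc]
      exact add_mem_maxPow (mul_mem_maxPow_left (hle n hu) (hall n).1)
        (mul_mem_maxPow_left (hle n hv) (hall n).2.1)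
    have := (hR.shift M).exists_height_one_of_constant_order hr
      (h := fun n => (u * a + v * b) / Y n) hmem (fun n => by
        induction n with
        | zero => simpa [Y] using huv
        | succ n ih =>
          have := (hR.step (M + n)).div_notMem_maxPow r _ (hmem n) ih
          rwa [← hYs] at this) (fun n => hYs n _)
    rw [hR.seqUnion_shift M] at this
    simpa [Y] using this

theorem valuationRing_of_switches (hR : QuadChain d R y)
    (h : SwitchesStronglyInfinitelyOften R) : ValuationRing (seqUnion R) := by
  rw [Subring.valuationRing_iff]
  intro f hf g hg hf0 hg0
  by_contra! hcon
  obtain ⟨M, r, a, b, ha, hb, ha0, hb0, hab, -, hq⟩ :=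
    hR.exists_minimal_pair hf hg hf0 hg0 hcon.1 hcon.2
  apply h
  rcases hab with hab | hab
  · obtain ⟨q, h1, -, h2⟩ := hq 1 (one_mem _) 0 (zero_mem _) (by simpa using hab)
    exact ⟨M, q, h1, h2⟩
  · obtain ⟨q, h1, -, h2⟩ := hq 0 (zero_mem _) 1 (one_mem _) (by simpa using hab)
    exact ⟨M, q, h1, h2⟩

/-- In a minimal pair, combinations of order exactly r lie in the center of V, hence so do a and b.
Dividing both by x M keeps the ratio and lowers the order. -/
theorem valuationRing_of_unique_height_one (hR : QuadChain d R y) {V : LocalSubring K}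
    (hV : ∀ (k : ℕ) (q : PrimeSpectrum (R k).toSubring), q.asIdeal.height = 1 →
      seqUnion R ≤ (ofPrime (R k).toSubring q.asIdeal).toSubring →
      V = ofPrime (R k).toSubring q.asIdeal)
    {x : ℕ → K} (hx0 : ∀ n, x n ≠ 0) (hxm : ∀ n, x n ∈ (R n).maxPow 1)
    (hx : ∀ n, ∀ a ∈ (R n).toSubring, a ∈ V.maxPow 1 → a / x n ∈ (R n).toSubring) :
    ValuationRing (seqUnion R) := by
  rw [Subring.valuationRing_iff]
  intro f hf g hg hf0 hg0
  by_contra! hcon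
  obtain ⟨M, r, a, b, ha, hb, ha0, hb0, hab, hmin, hq⟩ :=
    hR.exists_minimal_pair hf hg hf0 hg0 hcon.1 hcon.2
  have hq' : ∀ u ∈ (R M).toSubring, ∀ v ∈ (R M).toSubring, u * a + v * b ∉ (R M).maxPow (r + 1) →
      u * a + v * b ∈ V.maxPow 1 := by
    intro u hu v hv h
    obtain ⟨q, h1, h2, h3⟩ := hq u hu v hv h
    rwa [hV M q h1 h3]
  have hV' : a ∈ V.maxPow 1 ∧ b ∈ V.maxPow 1 := by
    have e1 := hq' 1 (one_mem _) 0 (zero_mem _)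
    have e2 := hq' 0 (zero_mem _) 1 (one_mem _)
    -- If one of a, b has order above r, the sum a + b still has order r, and the former is
    -- recovered as a difference.
    have e3 := hq' 1 (one_mem _) 1 (one_mem _)
    simp only [one_mul, zero_mul, add_zero, zero_add] at e1 e2 e3
    rcases hab with hab | hab
    · have h1 := e1 hab
      by_cases hb' : b ∈ (R M).maxPow (r + 1)
      · have h3 := e3 (fun h => hab (by simpa using sub_mem_maxPow h hb'))
        exact ⟨h1, by simpa using sub_mem_maxPow h3 h1⟩
      · exact ⟨h1, e2 hb'⟩
    · have h1 := e2 hab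
      by_cases ha' : a ∈ (R M).maxPow (r + 1)
      · have h3 := e3 (fun h => hab (by simpa using sub_mem_maxPow h ha'))
        exact ⟨by simpa using sub_mem_maxPow h3 h1, h1⟩
      · exact ⟨e1 ha', h1⟩
  have ha' := hx M a ha.1 hV'.1
  have hb' := hx M b hb.1 hV'.2
  have hmul : ∀ c, c / x M * x M = c := fun c => div_mul_cancel₀ c (hx0 M)
  rcases r with _ | r
  · have h1 : ∀ c, c / x M ∈ (R M).toSubring → c ∈ (R M).maxPow 1 := fun c hc => by
      rw [← hmul c]; exact mul_mem_maxPow_left hc (hxm M)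
    exact hab.elim (fun h => h (h1 _ ha')) (fun h => h (h1 _ hb'))
  · have h1 : ∀ c, c / x M ∈ (R M).maxPow (r + 1) → c ∈ (R M).maxPow (r + 1 + 1) := fun c hc => by
      rw [← hmul c]; exact mul_mem_maxPow hc (hxm M)
    have := hmin (x M) (hx0 M) ha' hb' r (hab.imp (fun h h' => h (h1 _ h')) fun h h' => h (h1 _ h'))
    omega

/-- The nonunit s of the union is divisible by `y j` for all large j. As s is a unit of the
localization W, so are these `y j`, and W is a localization of a single Noetherian R i. A Noetherian
valuation ring that is not a field has dimension one. -/
theorem ofPrime_eq_of_valuationRing (hR : QuadChain d R y) [hval : ValuationRing (seqUnion R)]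
    {q : Ideal (seqUnion R)} [q.IsPrime] (hq : q ≠ ⊥) {s : K} (hs : s ∈ seqUnion R)
    (hsi : s⁻¹ ∉ seqUnion R) (hsq : s ∉ (ofPrime (seqUnion R) q).maxPow 1) :
    ∃ (i : ℕ) (p : PrimeSpectrum (R i).toSubring), p.asIdeal.height = 1 ∧
      ofPrime (R i).toSubring p.asIdeal = ofPrime (seqUnion R) q := by
  set W := ofPrime (seqUnion R) q with hWdef
  have hSW : seqUnion R ≤ W.toSubring := le_ofPrime _ q
  have hRW : ∀ n, (R n).toSubring ≤ W.toSubring := fun n => (le_seqUnion R n).trans hSW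
  obtain ⟨i, hi⟩ := hR.mem_seqUnion.1 hs
  have hsm : s ∈ (R i).maxPow 1 := mem_maxPow_one_iff.2 ⟨hi, Or.inr fun h => hsi (le_seqUnion R i h)⟩
  have hy : ∀ j, i ≤ j → y j ∉ W.maxPow 1 := by
    intro j hj hyj
    apply hsq
    rw [← div_mul_cancel₀ s (hR.step j).ne_zero]
    exact mul_mem_maxPow_left (hRW _ ((hR.step j).div_mem s (hR.mem_maxPow_one hj hsm))) hyj
  have hfrac : ∀ j, i ≤ j → ∀ c ∈ (R j).toSubring, ∃ a ∈ (R i).toSubring, ∃ t ∈ (R i).toSubring,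
      t ≠ 0 ∧ t⁻¹ ∈ W.toSubring ∧ c = a / t := by
    intro j hj
    induction j, hj using Nat.le_induction with
    | base => exact fun c hc => ⟨c, hc, 1, one_mem _, one_ne_zero, by simp [one_mem], by simp⟩
    | succ j hj ih =>
      intro c hc
      have hst := hR.step j
      obtain ⟨a, ha, t, ht, k, ht0, hk, hki, rfl⟩ := hst.frac c hc
      have hti : t⁻¹ ∈ W.toSubring := by
        have h1 := inv_mem (hRW _ hst.mem_target.1) (hy j hj)
        have := mul_mem (hRW _ hki) (pow_mem h1 k)
        convert this using 1
        have := hst.ne_zero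
        rw [inv_pow]
        field_simp
      obtain ⟨a1, ha1, t1, ht1, ht10, ht1i, rfl⟩ := ih a ha
      obtain ⟨a2, ha2, t2, ht2, ht20, ht2i, rfl⟩ := ih t ht
      have ha20 : a2 ≠ 0 := fun h0 => ht0 (by rw [h0, zero_div])
      refine ⟨a1 * t2, mul_mem ha1 ht2, t1 * a2, mul_mem ht1 ha2, mul_ne_zero ht10 ha20, ?_, ?_⟩
      · have := mul_mem ht1i (mul_mem hti ht2i)
        convert this using 1
        field_simp
      · field_simp
  have hfracS : ∀ c ∈ seqUnion R, ∃ a ∈ (R i).toSubring, ∃ t ∈ (R i).toSubring,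
      t ≠ 0 ∧ t⁻¹ ∈ W.toSubring ∧ c = a / t := by
    intro c hc
    obtain ⟨j, hj⟩ := hR.mem_seqUnion.1 hc
    exact hfrac _ (le_max_left i j) c (hR.monotone (le_max_right i j) hj)
  have hWi : ofPrime (R i).toSubring (W.center (hRW i)) = W := by
    apply ofPrime_center_eq
    intro c hc
    obtain ⟨a, t, ht, rfl⟩ := mem_ofPrime.1 hc
    have ht0 := coe_ne_zero_of_not_mem ht
    obtain ⟨a1, ha1, t1, ht1, ht10, ht1i, ea⟩ := hfracS a a.2
    obtain ⟨a2, ha2, t2, ht2, ht20, ht2i, et⟩ := hfracS t t.2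
    have ha20 : a2 ≠ 0 := fun h0 => ht0 (by rw [et, h0, zero_div])
    refine ⟨a1 * t2, mul_mem ha1 ht2, t1 * a2, mul_mem ht1 ha2, mul_ne_zero ht10 ha20, ?_, ?_⟩
    · have h1 : (t : K)⁻¹ ∈ W.toSubring := inv_mem (hSW t.2) (by rwa [mem_maxPow_ofPrime])
      have := mul_mem ht1i (mul_mem h1 ht2i)
      convert this using 1
      rw [et]; field_simp
    · rw [ea, et]; field_simp
  refine ⟨i, ⟨W.center (hRW i), inferInstance⟩, ?_, hWi⟩
  have hreg := hR.regular i
  have hnoeth : IsNoetherianRing W.toSubring := by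
    rw [← hWi]; exact isNoetherianRing_ofPrime _
  have hvalW : ValuationRing W.toSubring := (fractionsOf_ofPrime (seqUnion R) q).valuationRing hSW
  have hpid : IsPrincipalIdealRing W.toSubring := inferInstance
  have hnf : ¬ IsField W.toSubring := by
    intro hf
    obtain ⟨a, haq, ha0⟩ := Submodule.exists_mem_ne_zero_of_ne_bot hq
    have ha := mem_maxPow_ofPrime.2 haq
    have ha0' : (a : K) ≠ 0 := fun h => ha0 (Subtype.ext h)
    obtain ⟨b, hb⟩ := hf.mul_inv_cancel (a := ⟨a, hSW a.2⟩) (fun h => ha0' (congrArg Subtype.val h))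
    refine not_mem_maxPow_one ha0' ?_ ha
    rw [inv_eq_of_mul_eq_one_right (congrArg Subtype.val hb : (a : K) * b = 1)]
    exact b.2
  have hdim := IsPrincipalIdealRing.ringKrullDim_eq_one W.toSubring hnf
  rw [← hWi, ringKrullDim_ofPrime] at hdim
  exact WithBot.coe_injective hdim

end QuadChain

/-! ### The discrete valuation ring of x along the sequence -/

namespace LocalSubring

theorem mem_maxPow_one_of_le {A W : LocalSubring K} (h : A.toSubring ≤ W.toSubring) {a : K}
    (ha : a ∈ A.toSubring) (haW : a ∈ W.maxPow 1) : a ∈ A.maxPow 1 := by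
  rw [mem_maxPow_one_iff] at haW ⊢
  exact ⟨ha, haW.2.imp_right fun h1 h2 => h1 (h h2)⟩

theorem mem_maxPow_range {B : Type*} [CommRing B] [IsLocalRing B] (f : B →+* K) {r : ℕ} {z : K} :
    z ∈ (range f).maxPow r ↔ ∃ b ∈ maximalIdeal B ^ r, f b = z := by
  let g : B →+* (range f).toSubring := f.rangeRestrict
  have hg : Function.Surjective g := f.rangeRestrict_surjective
  have hloc : IsLocalHom g := IsLocalHom.of_surjective g hg
  have hm : maximalIdeal (range f).toSubring = (maximalIdeal B).map g := by
    rw [← IsLocalRing.maximalIdeal_comap g, Ideal.map_comap_of_surjective _ hg]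
  have key : ∀ w : (range f).toSubring, w ∈ maximalIdeal (range f).toSubring ^ r ↔
      ∃ b ∈ maximalIdeal B ^ r, g b = w := fun w => by
    rw [hm, ← Ideal.map_pow, Ideal.mem_map_iff_of_surjective g hg]
  constructor
  · rintro ⟨hz, h⟩
    obtain ⟨b, hb, e⟩ := (key _).1 h
    exact ⟨b, hb, congrArg Subtype.val e⟩
  · rintro ⟨b, hb, rfl⟩
    exact coe_mem_maxPow.2 ((key (g b)).2 ⟨b, hb, rfl⟩)

theorem ofPrime_congr {B : Subring K} {p q : Ideal B} [p.IsPrime] [q.IsPrime] (h : p = q) :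
    ofPrime B p = ofPrime B q := by
  subst h; rfl

theorem valuationRing_ofPrime_span_singleton {B : Subring K} [IsNoetherianRing B] {x : B}
    [(Ideal.span {x}).IsPrime] : ValuationRing (ofPrime B (Ideal.span {x})).toSubring := by
  have := isNoetherianRing_ofPrime (Ideal.span {x})
  -- Items 4 and 1 of the list: principal maximal ideal, valuation ring.
  have h := (tfae_of_isNoetherianRing_of_isLocalRing_of_isDomain
    (ofPrime B (Ideal.span {x})).toSubring).out 4 1
  refine h.1 ?_
  rw [← IsLocalization.AtPrime.map_eq_maximalIdeal (Ideal.span {x}), Ideal.map_span,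
    Set.image_singleton]
  exact ⟨_, rfl⟩

end LocalSubring

/-- Since 𝔪ᵢ is contained in yᵢRᵢ₊₁, a nonunit yᵢ would make the center on Rᵢ equal to 𝔪ᵢ, of height
d ≥ 2, whereas centers keep the height 1 of q. -/
theorem QuadChain.notMem_of_height_eq_one {d : ℕ} {R : ℕ → LocalSubring K} {y : ℕ → K}
    (hR : QuadChain d R y) (hd : 2 ≤ d) {k : ℕ} {q : Ideal (R k).toSubring} [q.IsPrime]
    (hq : q.height = 1) (hS : seqUnion R ≤ (ofPrime (R k).toSubring q).toSubring) {i : ℕ}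
    (hi : k ≤ i) : y i ∉ (ofPrime (R k).toSubring q).maxPow 1 := by
  intro hy
  have hle : (R i).toSubring ≤ (ofPrime (R k).toSubring q).toSubring := (le_seqUnion R i).trans hS
  have h1 := center_height_eq (hR.monotone hi) hle
  have h2 : (ofPrime (R k).toSubring q).center hle = maximalIdeal (R i).toSubring := by
    refine le_antisymm (IsLocalRing.le_maximalIdeal (Ideal.IsPrime.ne_top inferInstance)) ?_
    intro a ha
    rw [mem_center]
    have := (hR.step i).div_mem a (coe_mem_maxPow_one.2 ha)
    rw [← div_mul_cancel₀ (a : K) (hR.step i).ne_zero]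
    exact mul_mem_maxPow_left (hS (le_seqUnion R _ this)) hy
  rw [h2, hq] at h1
  have h3 := IsLocalRing.maximalIdeal_height_eq_ringKrullDim (R := (R i).toSubring)
  rw [h1, hR.dim] at h3
  have : 1 = d := by exact_mod_cast h3
  omega

/-- The union of the chain is contained in the discrete valuation ring `V`, which is the localization
of each `R n` at the prime ideal generated by `x n`. -/
structure DirectedChain (d : ℕ) (R : ℕ → LocalSubring K) (y : ℕ → K) (V : LocalSubring K)
    (x : ℕ → K) : Prop extends QuadChain d R y where
  two_le : 2 ≤ d
  le : seqUnion R ≤ V.toSubring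
  valuationRing : ValuationRing V.toSubring
  ringKrullDim_eq : ringKrullDim V.toSubring = 1
  ofPrime_center : ∀ n, ofPrime (R n).toSubring (V.center ((le_seqUnion R n).trans le)) = V
  y_notMem : ∀ n, y n ∉ V.maxPow 1
  x_mem : ∀ n, x n ∈ (R n).maxPow 1
  x_notMem : ∀ n, x n ∉ (R n).maxPow 2
  x_mem_center : ∀ n, x n ∈ V.maxPow 1
  div_mem : ∀ n, ∀ a ∈ (R n).toSubring, a ∈ V.maxPow 1 → a / x n ∈ (R n).toSubring
  x_succ : ∀ n, x (n + 1) = x n / y n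

/-- x / (y₀⋯yₙ₋₁) stays in the maximal ideal of V because the yᵢ are units there, and its order
stays one. So it generates a prime of Rₙ, which is the center of V because the latter has height
one. -/
theorem QuadChain.exists_directedChain {d : ℕ} (hd : 2 ≤ d) {R : ℕ → LocalSubring K} {y : ℕ → K}
    (hR : QuadChain d R y) (x : (R 0).toSubring) [hxp : (Ideal.span {x}).IsPrime]
    (hxm : x ∈ maximalIdeal (R 0).toSubring) (hxm2 : x ∉ maximalIdeal (R 0).toSubring ^ 2)
    (hS : seqUnion R ≤ (ofPrime (R 0).toSubring (Ideal.span {x})).toSubring) :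
    ∃ X : ℕ → K, X 0 = x ∧
      DirectedChain d R y (ofPrime (R 0).toSubring (Ideal.span {x})) X := by
  have hreg := hR.regular
  have hx0 : (x : K) ≠ 0 := fun h => hxm2 (by
    have : x = 0 := Subtype.ext h
    rw [this]; exact Ideal.zero_mem _)
  have hheight : (Ideal.span {x}).height = 1 :=
    Ideal.height_span_singleton_eq_one_of_mem_nonZeroDivisors
      (mem_nonZeroDivisors_of_ne_zero fun h => hx0 (congrArg Subtype.val h)) hxm
  set V := ofPrime (R 0).toSubring (Ideal.span {x}) with hV
  have hyV : ∀ n, y n ∉ V.maxPow 1 := fun n =>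
    hR.notMem_of_height_eq_one hd hheight hS (Nat.zero_le n)
  have hRV : ∀ n, (R n).toSubring ≤ V.toSubring := fun n => (le_seqUnion R n).trans hS
  let X : ℕ → K := fun n => x / ∏ i ∈ Finset.range n, y i
  have hXs : ∀ n, X (n + 1) = X n / y n := fun n => by
    simp only [X]
    rw [Finset.prod_range_succ, div_div]
  have hall : ∀ n, X n ∈ (R n).maxPow 1 ∧ X n ∉ (R n).maxPow 2 ∧ X n ∈ V.maxPow 1 ∧
      ∀ a ∈ (R n).toSubring, a ∈ V.maxPow 1 → a / X n ∈ (R n).toSubring := by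
    intro n
    induction n with
    | zero =>
      have hX0 : X 0 = x := by simp [X]
      rw [hX0]
      refine ⟨coe_mem_maxPow_one.2 hxm, fun h => hxm2 (coe_mem_maxPow.1 h),
        mem_maxPow_ofPrime.2 (Ideal.mem_span_singleton_self x), fun a ha haV => ?_⟩
      have h1 : (⟨a, ha⟩ : (R 0).toSubring) ∈ Ideal.span {x} := mem_maxPow_ofPrime.1 haV
      obtain ⟨c, hc⟩ := Ideal.mem_span_singleton.1 h1
      have : a = x * c := congrArg Subtype.val hc
      rw [this, mul_div_cancel_left₀ _ hx0]
      exact c.2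
    | succ n ih =>
      obtain ⟨h1, h2, h3, -⟩ := ih
      have hst := hR.step n
      have e1 : X (n + 1) ∈ (R (n + 1)).toSubring := by rw [hXs]; exact hst.div_mem _ h1
      have e2 : X (n + 1) ∈ V.maxPow 1 := by
        rw [hXs, div_eq_mul_inv]
        exact mul_mem_maxPow_right h3 (inv_mem (hRV _ hst.mem_target.1) (hyV n))
      have e3 := mem_maxPow_one_of_le (hRV _) e1 e2
      have e4 : X (n + 1) ∉ (R (n + 1)).maxPow 2 := by
        have := hst.div_notMem_maxPow 1 _ h1 h2
        rwa [pow_one, ← hXs] at this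
      refine ⟨e3, e4, e2, fun a ha haV => ?_⟩
      have e0 := ne_zero_of_not_mem e4
      have hreg' := hreg (n + 1)
      obtain ⟨d', rfl⟩ := Nat.exists_eq_add_of_le' (one_le_two.trans hd)
      obtain ⟨hq, hqd⟩ := IsRegularLocalRing.quotient_span_singleton (hR.dim (n + 1))
        (y := ⟨X (n + 1), e1⟩) (coe_mem_maxPow_one.1 e3) (fun h => e4 (coe_mem_maxPow.2 h))
      have hdom := IsRegularLocalRing.isDomain_of_ringKrullDim_eq d' _ hqd
      have hprime := (Ideal.Quotient.isDomain_iff_prime _).1 hdom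
      have heq := Ideal.eq_of_le_of_height_eq_one
        ((center_height_eq (hR.monotone (Nat.zero_le (n + 1))) (hRV (n + 1))).trans hheight)
        ((Ideal.span_singleton_le_iff_mem _).2 (mem_center.2 e2 :
          (⟨X (n + 1), e1⟩ : (R (n + 1)).toSubring) ∈ V.center (hRV (n + 1)))) (by
          rw [Ne, Ideal.span_singleton_eq_bot]
          exact fun h => e0 (congrArg Subtype.val h))
      have ha' : (⟨a, ha⟩ : (R (n + 1)).toSubring) ∈ V.center (hRV (n + 1)) := mem_center.2 haV
      rw [← heq] at ha'
      obtain ⟨c, hc⟩ := Ideal.mem_span_singleton.1 ha'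
      have : a = X (n + 1) * c := congrArg Subtype.val hc
      rw [this, mul_div_cancel_left₀ _ e0]
      exact c.2
  refine ⟨X, by simp [X], hR, hd, hS, valuationRing_ofPrime_span_singleton, ?_, fun n =>
    ofPrime_center_of_le (hR.monotone (Nat.zero_le n)) (hRV n), hyV, fun n => (hall n).1,
    fun n => (hall n).2.1, fun n => (hall n).2.2.1, fun n => (hall n).2.2.2, hXs⟩
  rw [ringKrullDim_ofPrime, hheight]
  rfl

/-! ### The residue sequence -/

section Residue

variable {d : ℕ} {R : ℕ → LocalSubring K} {y x : ℕ → K} {V : LocalSubring K}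

/-- The map `S → T → Frac T`. -/
noncomputable def residueHom (hS : seqUnion R ≤ V.toSubring) :
    seqUnion R →+* FractionRing (ResidueUnion hS) :=
  (algebraMap (ResidueUnion hS) (FractionRing (ResidueUnion hS))).comp
    (Ideal.Quotient.mk (centerIdeal hS))

variable {hS : seqUnion R ≤ V.toSubring}

theorem residueHom_eq_zero {s : seqUnion R} : residueHom hS s = 0 ↔ (s : K) ∈ V.maxPow 1 := by
  rw [residueHom, RingHom.comp_apply, map_eq_zero_iff _ (IsFractionRing.injective _ _),
    Ideal.Quotient.eq_zero_iff_mem]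
  exact mem_center

theorem residueMap_apply {n : ℕ} (a : (R n).toSubring) :
    residueMap hS n a = residueHom hS ⟨a, le_seqUnion R n a.2⟩ := rfl

theorem ker_residueMap (n : ℕ) :
    RingHom.ker (residueMap hS n) = V.center ((le_seqUnion R n).trans hS) := by
  ext a
  rw [RingHom.mem_ker, residueMap_apply, residueHom_eq_zero, mem_center]

theorem mem_residueSeq {n : ℕ} {z : FractionRing (ResidueUnion hS)} :
    z ∈ (residueSeq hS n).toSubring ↔ ∃ a, ∃ h : a ∈ (R n).toSubring,
      residueHom hS ⟨a, le_seqUnion R n h⟩ = z := by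
  constructor
  · rintro h
    obtain ⟨a, rfl⟩ : ∃ a, residueMap hS n a = z := h
    exact ⟨a, a.2, rfl⟩
  · rintro ⟨a, ha, rfl⟩
    exact ⟨⟨a, ha⟩, rfl⟩

theorem mem_maxPow_residueSeq {n r : ℕ} {z : FractionRing (ResidueUnion hS)} :
    z ∈ (residueSeq hS n).maxPow r ↔ ∃ a, ∃ h : a ∈ (R n).maxPow r,
      residueHom hS ⟨a, le_seqUnion R n h.1⟩ = z := by
  rw [residueSeq, mem_maxPow_range]
  constructor
  · rintro ⟨a, ha, rfl⟩
    exact ⟨a, coe_mem_maxPow.2 ha, rfl⟩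
  · rintro ⟨a, ha, rfl⟩
    exact ⟨⟨a, ha.1⟩, coe_mem_maxPow.1 ha, rfl⟩

namespace DirectedChain

theorem mem_V (h : DirectedChain d R y V x) {n : ℕ} {a : K} (ha : a ∈ (R n).toSubring) :
    a ∈ V.toSubring := h.le (le_seqUnion R n ha)

theorem x_ne_zero (h : DirectedChain d R y V x) (n : ℕ) : x n ≠ 0 :=
  ne_zero_of_not_mem (h.x_notMem n)

theorem center_height (h : DirectedChain d R y V x) (n : ℕ) :
    (V.center ((le_seqUnion R n).trans h.le)).height = 1 := by
  have h1 := ringKrullDim_ofPrime (P := V.center ((le_seqUnion R n).trans h.le))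
  rw [h.ofPrime_center, h.ringKrullDim_eq] at h1
  exact (WithBot.coe_injective h1).symm

theorem fractionsOf (h : DirectedChain d R y V x) (n : ℕ) :
    FractionsOf V.toSubring (R n).toSubring := by
  have := fractionsOf_ofPrime (R n).toSubring (V.center ((le_seqUnion R n).trans h.le))
  rwa [h.ofPrime_center] at this

/-- A localization at a height one prime containing `V` is equal to `V`. -/
theorem eq_of_le (h : DirectedChain d R y V x) {n : ℕ} {q : Ideal (R n).toSubring} [q.IsPrime]
    (hq : q ≠ ⊥) (hle : V.toSubring ≤ (ofPrime (R n).toSubring q).toSubring) :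
    V = ofPrime (R n).toSubring q := by
  have := h.valuationRing
  obtain ⟨a, ha, ha0⟩ := Submodule.exists_mem_ne_zero_of_ne_bot hq
  exact eq_of_le_of_ringKrullDim_le_one hle h.ringKrullDim_eq.le
    ((fractionsOf_ofPrime _ q).mono ((le_seqUnion R n).trans h.le)) (h.mem_V a.2)
    (fun h0 => ha0 (Subtype.ext h0)) (mem_maxPow_ofPrime.2 ha)

theorem isPrimeTransform (h : DirectedChain d R y V x) (n : ℕ) :
    IsPrimeTransform (V.center ((le_seqUnion R 0).trans h.le))
      (RingHom.ker (residueMap h.le n)) := by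
  have hmono : (R 0).toSubring ≤ (R n).toSubring := h.monotone (Nat.zero_le n)
  refine ⟨hmono, ⟨?_, ?_, ?_⟩, fun q hq hq1 hqc => ?_⟩
  · rw [ker_residueMap]; infer_instance
  · rw [ker_residueMap, h.center_height]
  · rw [ker_residueMap]
    rfl
  -- A prime over xR₀ has a localization containing (R₀)_{xR₀} = V; at height one it must equal V,
  -- so q is the center.
  · have hle : V.toSubring ≤ (ofPrime (R n).toSubring q).toSubring := by
      rw [← h.ofPrime_center 0]
      intro z hz
      obtain ⟨a, s, hs, rfl⟩ := mem_ofPrime.1 hz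
      rw [← hqc] at hs
      exact mem_ofPrime.2 ⟨Subring.inclusion hmono a, Subring.inclusion hmono s, hs, rfl⟩
    have hq0 : q ≠ ⊥ := by
      rintro rfl
      rw [Ideal.height_bot] at hq1
      exact zero_ne_one hq1
    have hVW := h.eq_of_le hq0 hle
    rw [ker_residueMap]
    ext a
    rw [mem_center, ← mem_maxPow_ofPrime (P := q), ← hVW]

theorem seqUnion_residueSeq_eq (h : DirectedChain d R y V x) : seqUnion (residueSeq h.le) =
    (algebraMap (ResidueUnion h.le) (FractionRing (ResidueUnion h.le))).range := by
  refine le_antisymm (iSup_le fun n z hz => ?_) ?_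
  · obtain ⟨a, ha, rfl⟩ := mem_residueSeq.1 hz
    exact ⟨_, rfl⟩
  · rintro z ⟨t, rfl⟩
    obtain ⟨s, rfl⟩ := Ideal.Quotient.mk_surjective t
    obtain ⟨n, hn⟩ := h.mem_seqUnion.1 s.2
    exact le_seqUnion (residueSeq h.le) n (mem_residueSeq.2 ⟨s, hn, rfl⟩)

theorem regular_residueSeq (h : DirectedChain d R y V x) (n : ℕ) :
    IsRegularLocalRing (residueSeq h.le n).toSubring ∧
      ringKrullDim (residueSeq h.le n).toSubring = (d - 1 : ℕ) := by
  have hreg := h.regular n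
  have hd := h.two_le
  obtain ⟨e, rfl⟩ := Nat.exists_eq_add_of_le' (one_le_two.trans hd)
  have hx := h.x_mem n
  obtain ⟨h1, h2⟩ := IsRegularLocalRing.quotient_span_singleton (h.dim n)
    (y := ⟨x n, hx.1⟩) (coe_mem_maxPow_one.1 hx) (fun h' => h.x_notMem n (coe_mem_maxPow.2 h'))
  have hker : Ideal.span {(⟨x n, hx.1⟩ : (R n).toSubring)} = RingHom.ker (residueMap h.le n) := by
    rw [ker_residueMap]
    apply le_antisymm
    · rw [Ideal.span_singleton_le_iff_mem]
      exact mem_center.2 (h.x_mem_center n)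
    · intro a ha
      have := h.div_mem n a a.2 (mem_center.1 ha)
      exact Ideal.mem_span_singleton.2 ⟨⟨_, this⟩, Subtype.ext
        (mul_div_cancel₀ (a : K) (h.x_ne_zero n)).symm⟩
  let e1 : ((R n).toSubring ⧸ Ideal.span {(⟨x n, hx.1⟩ : (R n).toSubring)}) ≃+*
      (residueSeq h.le n).toSubring :=
    (Ideal.quotEquivOfEq hker).trans (RingHom.quotientKerEquivRange (residueMap h.le n))
  refine ⟨IsRegularLocalRing.of_ringEquiv e1, ?_⟩
  rw [← ringKrullDim_eq_of_ringEquiv e1, h2]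
  rfl

theorem transform_residueSeq (h : DirectedChain d R y V x) (n : ℕ) :
    IsLocalQuadraticTransform (residueSeq h.le n) (residueSeq h.le (n + 1)) := by
  have hst := h.step n
  have hyR := hst.mem
  have hle1 := le_seqUnion R (n + 1)
  set π := residueHom h.le with hπ
  have hy' : π ⟨y n, le_seqUnion R n hyR.1⟩ ∈ (residueSeq h.le n).maxPow 1 :=
    mem_maxPow_residueSeq.2 ⟨_, hyR, rfl⟩
  have hy0 : π ⟨y n, le_seqUnion R n hyR.1⟩ ≠ 0 := fun h0 =>
    h.y_notMem n (residueHom_eq_zero.1 h0)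
  have hdiv : ∀ a (ha : a ∈ (R n).maxPow 1),
      π ⟨a / y n, hle1 (hst.div_mem a ha)⟩ = π ⟨a, le_seqUnion R n ha.1⟩ /
        π ⟨y n, le_seqUnion R n hyR.1⟩ := by
    intro a ha
    rw [eq_div_iff hy0, ← map_mul]
    exact congrArg π (Subtype.ext (div_mul_cancel₀ a hst.ne_zero))
  refine isLocalQuadraticTransform_of_frac hy' ?_ ?_ ?_ ?_
  -- Suppose y n = c * x n + b with b in 𝔪². If c is in 𝔪, then y n is in 𝔪². Otherwise division by
  -- y n gives 1 = c * x (n + 1) + b / y n, a sum of two nonunits of R (n + 1).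
  · intro h2
    obtain ⟨b, hb, hbe⟩ := mem_maxPow_residueSeq.1 h2
    have hyb : y n - b ∈ V.maxPow 1 :=
      (residueHom_eq_zero (hS := h.le)
        (s := ⟨y n, le_seqUnion R n hyR.1⟩ - ⟨b, le_seqUnion R n hb.1⟩)).1
        (by rw [map_sub, hbe, sub_self])
    have hc := h.div_mem n _ (sub_mem hyR.1 hb.1) hyb
    have hxn := h.x_ne_zero n
    have hcx : (y n - b) / x n * x n = y n - b := div_mul_cancel₀ _ hxn
    by_cases hcm : (y n - b) / x n ∈ (R n).maxPow 1
    · apply hst.notMem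
      have h3 := mul_mem_maxPow hcm (h.x_mem n)
      rw [hcx] at h3
      simpa using add_mem_maxPow h3 hb
    · have hci := hst.le (inv_mem hc hcm)
      have hbm : b / y n ∈ (R (n + 1)).maxPow 1 := by
        have h3 := mul_mem_maxPow_left (hst.div_pow_mem 2 hb) hst.mem_target
        have : b / y n ^ 2 * y n = b / y n := by
          have := hst.ne_zero
          field_simp
        rwa [this] at h3
      have hx1 := h.x_mem (n + 1)
      have h4 := add_mem_maxPow (mul_mem_maxPow_left (hst.le hc) hx1) hbm
      apply one_not_mem_maxPow (A := R (n + 1))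
      convert h4 using 1
      rw [h.x_succ]
      have := hst.ne_zero
      field_simp
      ring
  · refine Subring.closure_le.2 ?_
    rintro z (hz | ⟨⟨a, ha⟩, ham, rfl⟩)
    · obtain ⟨a, ha, rfl⟩ := mem_residueSeq.1 hz
      exact mem_residueSeq.2 ⟨a, hst.le ha, rfl⟩
    · obtain ⟨b, hb, rfl⟩ := mem_maxPow_residueSeq.1 (coe_mem_maxPow_one.2 ham)
      dsimp only
      rw [← hπ, ← hdiv b hb]
      exact mem_residueSeq.2 ⟨_, hst.div_mem b hb, rfl⟩
  · intro a ha
    obtain ⟨b, hb, rfl⟩ := mem_maxPow_residueSeq.1 ha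
    exact mem_maxPow_residueSeq.2 ⟨b, hst.mem_maxPow_one hb, rfl⟩
  -- The residue map carries the chart of R n into the chart of its image, so fractions over the one
  -- chart go to fractions over the other.
  · have hchart : ∀ b ∈ blowupChart (R n) ⟨y n, hyR.1⟩, ∃ hb : b ∈ seqUnion R,
        π ⟨b, hb⟩ ∈ blowupChart (residueSeq h.le n) ⟨_, hy'.1⟩ := by
      have hsub : blowupChart (R n) ⟨y n, hyR.1⟩ ≤
          ((blowupChart (residueSeq h.le n) ⟨_, hy'.1⟩).comap π).map (seqUnion R).subtype := by
        refine Subring.closure_le.2 ?_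
        rintro b (hb | ⟨a, ha, rfl⟩)
        · exact ⟨⟨b, le_seqUnion R n hb⟩, le_blowupChart _ _ (mem_residueSeq.2 ⟨b, hb, rfl⟩), rfl⟩
        · have ha' := coe_mem_maxPow_one.2 ha
          refine ⟨⟨_, hle1 (hst.div_mem a ha')⟩, ?_, rfl⟩
          have h5 : π ⟨a, le_seqUnion R n ha'.1⟩ ∈ (residueSeq h.le n).maxPow 1 :=
            mem_maxPow_residueSeq.2 ⟨a, ha', rfl⟩
          have h6 := div_mem_blowupChart (y := ⟨_, hy'.1⟩) h5
          dsimp only at h6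
          rw [← hdiv a ha'] at h6
          exact h6
      intro b hb
      obtain ⟨s, hs, rfl⟩ := hsub hb
      exact ⟨s.2, hs⟩
    intro c hc
    obtain ⟨c, hcR, rfl⟩ := mem_residueSeq.1 hc
    obtain ⟨a, ha, s, hs, hs0, hsi, rfl⟩ := hst.chart_frac hyR.1 c hcR
    obtain ⟨haS, ha'⟩ := hchart a ha
    obtain ⟨hsS, hs'⟩ := hchart s hs
    have hinv : π ⟨s, hsS⟩ * π ⟨s⁻¹, hle1 hsi⟩ = 1 := by
      rw [← map_mul, ← map_one π]
      exact congrArg π (Subtype.ext (mul_inv_cancel₀ hs0))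
    have hs1 : π ⟨s, hsS⟩ ≠ 0 := left_ne_zero_of_mul_eq_one hinv
    refine ⟨_, ha', _, hs', hs1, ?_, ?_⟩
    · rw [inv_eq_of_mul_eq_one_right hinv]
      exact mem_residueSeq.2 ⟨_, hsi, rfl⟩
    · rw [eq_div_iff hs1, ← map_mul]
      exact congrArg π (Subtype.ext (div_mul_cancel₀ a hs0))

theorem isQuadraticSequence_residueSeq (h : DirectedChain d R y V x) :
    IsQuadraticSequence (d - 1) (residueSeq h.le) :=
  ⟨(h.regular_residueSeq 0).1, fun n => (h.regular_residueSeq n).2, h.transform_residueSeq⟩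

end DirectedChain

end Residue

/-! ### Rank of the union of a switching sequence -/

theorem QuadChain.not_isField {d : ℕ} {R : ℕ → LocalSubring K} {y : ℕ → K}
    (hR : QuadChain d R y) : ¬ IsField (seqUnion R) := by
  intro hf
  have hst := hR.step 0
  obtain ⟨b, hb⟩ := hf.mul_inv_cancel (a := ⟨y 0, le_seqUnion R 0 hst.mem.1⟩)
    (fun h => hst.ne_zero (congrArg Subtype.val h))
  refine hR.inv_notMem_seqUnion hst.mem hst.ne_zero ?_
  rw [inv_eq_of_mul_eq_one_right (congrArg Subtype.val hb : (y 0 : K) * b = 1)]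
  exact b.2

/-- Localizing at a nonzero prime that misses a nonunit would give a height one localization of some
R i containing the union. -/
theorem QuadChain.ringKrullDim_eq_one_of_switches {d : ℕ} {R : ℕ → LocalSubring K} {y : ℕ → K}
    (hR : QuadChain d R y) (h : SwitchesStronglyInfinitelyOften R) :
    ringKrullDim (seqUnion R) = 1 := by
  have hval := hR.valuationRing_of_switches h
  rw [ringKrullDim_eq_one_iff_of_isLocalRing_isDomain]
  refine ⟨hR.not_isField, fun a ha => ?_⟩
  rw [Ideal.radical_eq_sInf]
  refine le_sInf fun J ⟨hJ, hJp⟩ s hs => ?_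
  by_contra hsJ
  have hJ0 : J ≠ ⊥ := by
    rintro rfl
    exact ha ((Submodule.span_singleton_eq_bot).1 (le_bot_iff.1 hJ))
  have hsi : (s : K)⁻¹ ∉ seqUnion R := fun hi => by
    have hs0 : (s : K) ≠ 0 := coe_ne_zero_of_not_mem hsJ
    exact hs (IsUnit.of_mul_eq_one (⟨_, hi⟩ : seqUnion R) (Subtype.ext (mul_inv_cancel₀ hs0)))
  obtain ⟨i, p, hp, he⟩ := hR.ofPrime_eq_of_valuationRing hJ0 s.2 hsi
    (by rwa [mem_maxPow_ofPrime])
  exact h ⟨i, p, hp, he ▸ le_ofPrime _ J⟩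

theorem value_residueHom_nonneg {R : ℕ → LocalSubring K} {V : LocalSubring K}
    {hS : seqUnion R ≤ V.toSubring} {ν : AddValuation (FractionRing (ResidueUnion hS)) (WithTop ℝ)}
    (hν : IsAssociatedRealValuation
      (algebraMap (ResidueUnion hS) (FractionRing (ResidueUnion hS))).range ν)
    (s : seqUnion R) : 0 ≤ ν (residueHom hS s) :=
  (hν _).1 ⟨_, rfl⟩

/-! ### Height one directedness, valuation rings and values -/

namespace DirectedChain

variable {d : ℕ} {R : ℕ → LocalSubring K} {y x : ℕ → K} {V : LocalSubring K}

theorem eq_of_heightOneDirected (h : DirectedChain d R y V x) (hd : HeightOneDirected R) {k : ℕ}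
    {q : PrimeSpectrum (R k).toSubring} (hq : q.asIdeal.height = 1)
    (hS : seqUnion R ≤ (ofPrime (R k).toSubring q.asIdeal).toSubring) :
    V = ofPrime (R k).toSubring q.asIdeal := by
  obtain ⟨j, p, hp, hpS, huniq⟩ := hd
  have h1 := huniq 0 ⟨V.center ((le_seqUnion R 0).trans h.le), inferInstance⟩ (h.center_height 0)
    (by rw [h.ofPrime_center]; exact h.le)
  rw [h.ofPrime_center] at h1
  rw [← h1]
  exact huniq k q hq hS

theorem heightOneDirected_of_unique (h : DirectedChain d R y V x)
    (hV : ∀ (k : ℕ) (q : PrimeSpectrum (R k).toSubring), q.asIdeal.height = 1 →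
      seqUnion R ≤ (ofPrime (R k).toSubring q.asIdeal).toSubring →
      V = ofPrime (R k).toSubring q.asIdeal) : HeightOneDirected R := by
  refine ⟨0, ⟨V.center ((le_seqUnion R 0).trans h.le), inferInstance⟩, h.center_height 0, ?_, ?_⟩
  · rw [h.ofPrime_center]; exact h.le
  · rw [h.ofPrime_center]; exact hV

theorem valuationRing_of_heightOneDirected (h : DirectedChain d R y V x)
    (hd : HeightOneDirected R) : ValuationRing (seqUnion R) :=
  h.valuationRing_of_unique_height_one (fun _ _ hq hS => h.eq_of_heightOneDirected hd hq hS)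
    h.x_ne_zero h.x_mem h.div_mem

/-- V and any other such localization are overrings of one valuation ring, hence comparable; both
have dimension one, hence they agree. -/
theorem heightOneDirected_of_valuationRing (h : DirectedChain d R y V x)
    [hval : ValuationRing (seqUnion R)] : HeightOneDirected R := by
  refine h.heightOneDirected_of_unique fun k q hq hS => ?_
  have hVval := h.valuationRing
  have hW : FractionsOf (ofPrime (R k).toSubring q.asIdeal).toSubring (seqUnion R) :=
    (fractionsOf_ofPrime _ q.asIdeal).mono (le_seqUnion R k)
  have hV : FractionsOf V.toSubring (seqUnion R) := (h.fractionsOf 0).mono (le_seqUnion R 0)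
  rcases hV.le_total hW h.le hS with hle | hle
  · refine h.eq_of_le ?_ hle
    rintro h0
    rw [h0, Ideal.height_bot] at hq
    exact zero_ne_one hq
  · have := hW.valuationRing hS
    refine (eq_of_le_of_ringKrullDim_le_one hle ?_ (hV.mono hS)
      (hS (le_seqUnion R 0 (h.x_mem 0).1)) (h.x_ne_zero 0) (h.x_mem_center 0)).symm
    rw [ringKrullDim_ofPrime, hq]
    rfl

/-! ### Values of the maximal ideals -/

section Value

/-- The image of `y n` in `T`. -/
noncomputable def residueGen (h : DirectedChain d R y V x) (n : ℕ) :
    FractionRing (ResidueUnion h.le) :=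
  residueHom h.le ⟨y n, le_seqUnion R n (h.step n).mem.1⟩

theorem residueGen_ne_zero (h : DirectedChain d R y V x) (n : ℕ) : h.residueGen n ≠ 0 := fun h0 =>
  h.y_notMem n (residueHom_eq_zero.1 h0)

variable {h : DirectedChain d R y V x}
  {ν : AddValuation (FractionRing (ResidueUnion h.le)) (WithTop ℝ)}

theorem exists_value_residueGen (h : DirectedChain d R y V x)
    (ν : AddValuation (FractionRing (ResidueUnion h.le)) (WithTop ℝ)) :
    ∃ c : ℕ → ℝ, ∀ n, ν (h.residueGen n) = c n := by
  have : ∀ n, ∃ c : ℝ, ν (h.residueGen n) = c := fun n => by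
    obtain ⟨c, hc⟩ := WithTop.ne_top_iff_exists.1
      (fun h0 => h.residueGen_ne_zero n (ν.top_iff.1 h0))
    exact ⟨c, hc.symm⟩
  choose c hc using this
  exact ⟨c, hc⟩

theorem isLeast_value (hν : IsAssociatedRealValuation
    (algebraMap (ResidueUnion h.le) (FractionRing (ResidueUnion h.le))).range ν) (n : ℕ) :
    IsLeast {r : WithTop ℝ | ∃ a ∈ maximalIdeal (residueSeq h.le n).toSubring,
      ν (a : FractionRing (ResidueUnion h.le)) = r} (ν (h.residueGen n)) := by
  have hst := h.step n
  constructor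
  · have hm : h.residueGen n ∈ (residueSeq h.le n).maxPow 1 :=
      mem_maxPow_residueSeq.2 ⟨_, hst.mem, rfl⟩
    exact ⟨⟨_, hm.1⟩, coe_mem_maxPow_one.1 hm, rfl⟩
  · rintro r ⟨a, ha, rfl⟩
    obtain ⟨b, hb, hba⟩ := mem_maxPow_residueSeq.1 (coe_mem_maxPow_one.2 ha)
    have hbS := le_seqUnion R (n + 1) (hst.div_mem b hb)
    have : (a : FractionRing (ResidueUnion h.le)) =
        residueHom h.le ⟨_, hbS⟩ * h.residueGen n := by
      rw [← hba, residueGen, ← map_mul]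
      exact congrArg _ (Subtype.ext (div_mul_cancel₀ b hst.ne_zero).symm)
    rw [this, ν.map_mul]
    exact le_add_of_nonneg_left (value_residueHom_nonneg hν _)

theorem valueSumDiverges_iff (hν : IsAssociatedRealValuation
    (algebraMap (ResidueUnion h.le) (FractionRing (ResidueUnion h.le))).range ν) {c : ℕ → ℝ}
    (hc : ∀ n, ν (h.residueGen n) = c n) :
    ValueSumDiverges (residueSeq h.le) ν ↔
      Tendsto (fun N => ∑ i ∈ Finset.range N, c i) atTop atTop := by
  constructor
  · rintro ⟨c', hc', ht⟩
    have : c' = c := funext fun n => WithTop.coe_injective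
      (((hc' n).unique (isLeast_value hν n)).trans (hc n))
    rwa [← this]
  · intro ht
    exact ⟨c, fun n => hc n ▸ isLeast_value hν n, ht⟩

/-- Value zero would put the inverse in T, but members of the maximal ideals stay nonunits in the
union. -/
theorem value_residueGen_pos (hν : IsAssociatedRealValuation
    (algebraMap (ResidueUnion h.le) (FractionRing (ResidueUnion h.le))).range ν) {c : ℕ → ℝ}
    (hc : ∀ n, ν (h.residueGen n) = c n) (n : ℕ) : 0 < c n := by
  have h0 : (0 : WithTop ℝ) ≤ c n := by
    rw [← hc]; exact value_residueHom_nonneg hν _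
  refine lt_of_le_of_ne (WithTop.coe_nonneg.1 h0) fun hcn => ?_
  have hm : h.residueGen n ∈ (residueSeq h.le n).maxPow 1 :=
    mem_maxPow_residueSeq.2 ⟨_, (h.step n).mem, rfl⟩
  have hinv : (h.residueGen n)⁻¹ ∈ seqUnion (residueSeq h.le) := by
    rw [h.seqUnion_residueSeq_eq, hν]
    have h1 : ν (h.residueGen n) + ν (h.residueGen n)⁻¹ = 0 := by
      rw [← ν.map_mul, mul_inv_cancel₀ (h.residueGen_ne_zero n), ν.map_one]
    rw [hc, ← hcn, WithTop.coe_zero, zero_add] at h1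
    exact h1.ge
  have hd := h.two_le
  obtain ⟨y', hy'⟩ := h.isQuadraticSequence_residueSeq.exists_quadChain (by omega)
  exact hy'.inv_notMem_seqUnion hm (h.residueGen_ne_zero n) hinv

theorem x_eq (h : DirectedChain d R y V x) (n : ℕ) :
    x n * ∏ i ∈ Finset.range n, y i = x 0 := by
  induction n with
  | zero => simp
  | succ n ih =>
    rw [Finset.prod_range_succ, h.x_succ, ← ih]
    have := (h.step n).ne_zero
    field_simp

/-- If the union `S` is a valuation ring, every element of `S` that is a unit of `V` divides a
product of the `y n`. -/
theorem exists_prod_div_mem (h : DirectedChain d R y V x) [hval : ValuationRing (seqUnion R)]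
    {s : K} (hs : s ∈ seqUnion R) (hsV : s ∉ V.maxPow 1) :
    ∃ n, (∏ i ∈ Finset.range n, y i) / s ∈ (R n).toSubring := by
  have hs0 := ne_zero_of_not_mem hsV
  have hx0 := h.x_ne_zero 0
  -- If instead x 0 divided s, then s would be a nonunit of V.
  have hxs : x 0 / s ∈ seqUnion R := by
    refine ((Subring.valuationRing_iff.1 hval) _ (le_seqUnion R 0 (h.x_mem 0).1) s hs hx0
      hs0).resolve_right fun h1 => hsV ?_
    rw [← div_mul_cancel₀ s hx0]
    exact mul_mem_maxPow_left (h.le h1) (h.x_mem_center 0)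
  have hxV : x 0 / s ∈ V.maxPow 1 := by
    rw [div_eq_mul_inv]
    exact mul_mem_maxPow_right (h.x_mem_center 0) (inv_mem (h.le hs) hsV)
  obtain ⟨n, hn⟩ := h.mem_seqUnion.1 hxs
  refine ⟨n, ?_⟩
  -- x n divides x 0 / s in R n, and x 0 / x n is the product of the first n of the `y i`.
  have h1 := h.div_mem n _ hn hxV
  convert h1 using 1
  rw [← h.x_eq n]
  have := h.x_ne_zero n
  field_simp

theorem value_prod {c : ℕ → ℝ} (hc : ∀ n, ν (h.residueGen n) = c n) (n : ℕ) :
    ν (∏ i ∈ Finset.range n, h.residueGen i) = ((∑ i ∈ Finset.range n, c i : ℝ) : WithTop ℝ) := by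
  induction n with
  | zero => simp
  | succ n ih =>
    rw [Finset.prod_range_succ, ν.map_mul, ih, hc, Finset.sum_range_succ, WithTop.coe_add]

/-- Each power y₀ ^ k divides some y₀⋯yₙ₋₁, so the partial sums exceed every multiple of the
positive value of y₀. -/
theorem valueSumDiverges_of_valuationRing [hval : ValuationRing (seqUnion R)]
    (hν : IsAssociatedRealValuation
    (algebraMap (ResidueUnion h.le) (FractionRing (ResidueUnion h.le))).range ν) :
    ValueSumDiverges (residueSeq h.le) ν := by
  obtain ⟨c, hc⟩ := h.exists_value_residueGen ν
  rw [valueSumDiverges_iff hν hc]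
  have hpos := value_residueGen_pos hν hc
  refine tendsto_atTop_atTop_of_monotone (monotone_nat_of_le_succ fun n => ?_) fun C => ?_
  · rw [Finset.sum_range_succ]
    exact le_add_of_nonneg_right (hpos n).le
  obtain ⟨k, hk⟩ := Archimedean.arch C (hpos 0)
  have hy0 := le_seqUnion R 0 (h.step 0).mem.1
  have hsV : y 0 ^ k ∉ V.maxPow 1 := by
    refine not_mem_maxPow_one (pow_ne_zero _ (h.step 0).ne_zero) ?_
    rw [← inv_pow]
    exact pow_mem (inv_mem (h.le hy0) (h.y_notMem 0)) k
  obtain ⟨n, hn⟩ := h.exists_prod_div_mem (pow_mem hy0 k) hsV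
  refine ⟨n, hk.trans ?_⟩
  have hprod : ∏ i ∈ Finset.range n, h.residueGen i =
      residueHom h.le ⟨_, le_seqUnion R n hn⟩ * h.residueGen 0 ^ k := by
    simp only [residueGen]
    rw [← map_prod, ← map_pow, ← map_mul]
    refine congrArg _ (Subtype.ext ?_)
    have := pow_ne_zero k (h.step 0).ne_zero
    push_cast
    field_simp
  have hv := value_prod hc n
  rw [hprod, ν.map_mul, ν.map_pow, hc, ← WithTop.coe_nsmul] at hv
  have h1 : ((k • c 0 : ℝ) : WithTop ℝ) ≤ ((∑ i ∈ Finset.range n, c i : ℝ) : WithTop ℝ) := by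
    rw [← hv]
    exact le_add_of_nonneg_left (value_residueHom_nonneg hν _)
  exact WithTop.coe_le_coe.1 h1

theorem heightOneDirected_of_valueSumDiverges (hν : IsAssociatedRealValuation
    (algebraMap (ResidueUnion h.le) (FractionRing (ResidueUnion h.le))).range ν)
    (hdiv : ValueSumDiverges (residueSeq h.le) ν) : HeightOneDirected R := by
  obtain ⟨c, hc⟩ := h.exists_value_residueGen ν
  rw [valueSumDiverges_iff hν hc] at hdiv
  refine h.heightOneDirected_of_unique fun k q hq hS => ?_
  set W := ofPrime (R k).toSubring q.asIdeal with hW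
  by_contra hVW
  -- Otherwise q would be contained in the center of V, and height one primes with an inclusion are
  -- equal.
  obtain ⟨f, hfq, hfV⟩ : ∃ f ∈ q.asIdeal, (f : K) ∉ V.maxPow 1 := by
    by_contra! hcon
    have hle : q.asIdeal ≤ V.center ((le_seqUnion R k).trans h.le) := fun f hf =>
      mem_center.2 (hcon f hf)
    have hreg := h.regular k
    have heq := Ideal.eq_of_le_of_height_eq_one (h.center_height k) hle (by
      rintro h0
      rw [h0, Ideal.height_bot] at hq
      exact zero_ne_one hq)
    apply hVW
    rw [hW, ofPrime_congr heq, h.ofPrime_center]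
  have hRW : ∀ n, (R n).toSubring ≤ W.toSubring := fun n => (le_seqUnion R n).trans hS
  -- A nonunit of W in R (k + n) is divisible by y (k + n), a unit of W; so the quotient is again a
  -- nonunit of W and the division can be repeated.
  have key : ∀ n, ∃ g, ∃ hg : g ∈ (R (k + n)).toSubring, g ∈ W.maxPow 1 ∧
      residueHom h.le ⟨f, le_seqUnion R k f.2⟩ =
        residueHom h.le ⟨g, le_seqUnion R _ hg⟩ * ∏ i ∈ Finset.range n, h.residueGen (k + i) := by
    intro n
    induction n with
    | zero => exact ⟨f, f.2, mem_maxPow_ofPrime.2 hfq, by simp⟩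
    | succ n ih =>
      obtain ⟨g, hg, hgW, he⟩ := ih
      have hst := h.step (k + n)
      have hgm := mem_maxPow_one_of_le (hRW _) hg hgW
      have hyW := h.notMem_of_height_eq_one h.two_le hq hS (Nat.le_add_right k n)
      refine ⟨g / y (k + n), hst.div_mem g hgm, ?_, ?_⟩
      · rw [div_eq_mul_inv]
        exact mul_mem_maxPow_right hgW (inv_mem (hRW _ hst.mem_target.1) hyW)
      · have : residueHom h.le ⟨g, le_seqUnion R _ hg⟩ =
            residueHom h.le ⟨g / y (k + n), le_seqUnion R _ (hst.div_mem g hgm)⟩ *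
              h.residueGen (k + n) := by
          rw [residueGen, ← map_mul]
          exact congrArg _ (Subtype.ext (div_mul_cancel₀ g hst.ne_zero).symm)
        rw [he, this, Finset.prod_range_succ]
        ring
  have hne : ν (residueHom h.le ⟨f, le_seqUnion R k f.2⟩) ≠ ⊤ := fun h0 =>
    hfV (residueHom_eq_zero.1 (ν.top_iff.1 h0))
  obtain ⟨C, hC⟩ := WithTop.ne_top_iff_exists.1 hne
  -- The first k values are added to the bound because f is divided only by generators of index at
  -- least k.
  obtain ⟨N, hN⟩ := (hdiv.eventually_gt_atTop (C + ∑ i ∈ Finset.range k, c i)).exists_forall_of_atTop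
  obtain ⟨g, hg, -, he⟩ := key N
  have h1 := hN (k + N) (Nat.le_add_left N k)
  rw [Finset.sum_range_add, add_comm] at h1
  have h2 : ν (∏ i ∈ Finset.range (k + N), h.residueGen i) ≤
      ν (residueHom h.le ⟨f, le_seqUnion R k f.2⟩) + ν (∏ i ∈ Finset.range k, h.residueGen i) := by
    rw [Finset.prod_range_add, he, ν.map_mul, ν.map_mul, add_comm]
    exact add_le_add_left (le_add_of_nonneg_left (value_residueHom_nonneg hν _)) _
  rw [value_prod hc, value_prod hc, ← hC, ← WithTop.coe_add, WithTop.coe_le_coe,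
    Finset.sum_range_add] at h2
  linarith

end Value

/-- The ring `T` is the union of the residue sequence. -/
theorem exists_residueUnion_equiv (h : DirectedChain d R y V x) :
    Nonempty (ResidueUnion h.le ≃+* seqUnion (residueSeq h.le)) := by
  rw [h.seqUnion_residueSeq_eq]
  exact ⟨RingEquiv.ofBijective
    (algebraMap (ResidueUnion h.le) (FractionRing (ResidueUnion h.le))).rangeRestrict
    ⟨fun a b hab => IsFractionRing.injective (ResidueUnion h.le) (FractionRing (ResidueUnion h.le))
      (congrArg Subtype.val hab), RingHom.rangeRestrict_surjective _⟩⟩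

theorem valuationRing_residueUnion_iff (h : DirectedChain d R y V x) :
    ValuationRing (ResidueUnion h.le) ↔ ValuationRing (seqUnion (residueSeq h.le)) := by
  obtain ⟨e⟩ := h.exists_residueUnion_equiv
  exact ⟨fun _ => Function.Surjective.valuationRing e.toRingHom e.surjective,
    fun _ => Function.Surjective.valuationRing e.symm.toRingHom e.symm.surjective⟩

theorem ringKrullDim_residueUnion (h : DirectedChain d R y V x) :
    ringKrullDim (ResidueUnion h.le) = ringKrullDim (seqUnion (residueSeq h.le)) := by
  obtain ⟨e⟩ := h.exists_residueUnion_equiv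
  exact ringKrullDim_eq_of_ringEquiv e

theorem exists_quadChain_residueSeq (h : DirectedChain d R y V x) :
    ∃ y', QuadChain (d - 1) (residueSeq h.le) y' :=
  h.isQuadraticSequence_residueSeq.exists_quadChain (by have := h.two_le; omega)

/-- A nonzero nonmaximal prime of T pulls back to a prime q of S strictly larger than P. Then S_q is
a height one localization of some R i, so it is V, and q would be P. -/
theorem ringKrullDim_residueUnion_eq_one (h : DirectedChain d R y V x)
    [hval : ValuationRing (seqUnion R)] [ValuationRing (ResidueUnion h.le)] :
    ringKrullDim (ResidueUnion h.le) = 1 := by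
  obtain ⟨y', hy'⟩ := h.exists_quadChain_residueSeq
  obtain ⟨e⟩ := h.exists_residueUnion_equiv
  rw [ringKrullDim_eq_one_iff_of_isLocalRing_isDomain]
  refine ⟨fun hf => hy'.not_isField (e.symm.toMulEquiv.isField hf), fun a ha => ?_⟩
  rw [Ideal.radical_eq_sInf]
  refine le_sInf fun J ⟨hJ, hJp⟩ t ht => ?_
  by_contra htJ
  obtain ⟨s, rfl⟩ := Ideal.Quotient.mk_surjective t
  obtain ⟨b, rfl⟩ := Ideal.Quotient.mk_surjective a
  let q := J.comap (Ideal.Quotient.mk (centerIdeal h.le))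
  have hqp : q.IsPrime := Ideal.comap_isPrime _ _
  have hbq : b ∈ q := hJ (Ideal.mem_span_singleton_self _)
  have hbV : (b : K) ∉ V.maxPow 1 := fun hb => ha (Ideal.Quotient.eq_zero_iff_mem.2
    (mem_center.2 hb))
  have hsq : s ∉ q := htJ
  have hsi : (s : K)⁻¹ ∉ seqUnion R := fun hi => by
    have hs0 : (s : K) ≠ 0 := coe_ne_zero_of_not_mem hsq
    have hu : IsUnit s := IsUnit.of_mul_eq_one (⟨_, hi⟩ : seqUnion R)
      (Subtype.ext (mul_inv_cancel₀ hs0))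
    exact ht (hu.map _)
  have hq0 : q ≠ ⊥ := by
    intro h0
    rw [h0, Ideal.mem_bot] at hbq
    exact hbV (by rw [hbq]; exact zero_mem_maxPow)
  obtain ⟨i, p, hp, he⟩ := h.ofPrime_eq_of_valuationRing hq0 s.2 hsi
    (by rwa [mem_maxPow_ofPrime])
  have hVp := h.eq_of_heightOneDirected h.heightOneDirected_of_valuationRing hp
    (he ▸ le_ofPrime _ q)
  apply hbV
  rw [hVp, he, mem_maxPow_ofPrime]
  exact hbq

/-- A height one localization containing the rank one valuation ring T equals T. As d - 1 ≥ 2, the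
generators y' are units of that localization, yet they are nonunits of T. -/
theorem switches_residueSeq (h : DirectedChain d R y V x) (hd : 3 ≤ d)
    [hT : ValuationRing (ResidueUnion h.le)] (hdim : ringKrullDim (ResidueUnion h.le) = 1) :
    SwitchesStronglyInfinitelyOften (residueSeq h.le) := by
  rintro ⟨j, q, hq, hle⟩
  obtain ⟨y', hy'⟩ := h.exists_quadChain_residueSeq
  have hval := h.valuationRing_residueUnion_iff.1 hT
  have hloc : IsLocalRing (seqUnion (residueSeq h.le)) :=
    ValuationRing.isLocalRing _
  let T := @LocalSubring.mk _ _ (seqUnion (residueSeq h.le)) hloc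
  have hvalT : ValuationRing T.toSubring := hval
  obtain ⟨a, ha, ha0⟩ := Submodule.exists_mem_ne_zero_of_ne_bot (p := q.asIdeal) (by
    rintro h0
    rw [h0, Ideal.height_bot] at hq
    exact zero_ne_one hq)
  have hTW : T = ofPrime (residueSeq h.le j).toSubring q.asIdeal := by
    refine eq_of_le_of_ringKrullDim_le_one hle ?_ ((fractionsOf_ofPrime _ q.asIdeal).mono
      (le_seqUnion (residueSeq h.le) j)) (le_seqUnion (residueSeq h.le) j a.2)
      (fun h0 => ha0 (Subtype.ext h0)) (mem_maxPow_ofPrime.2 ha)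
    exact (h.ringKrullDim_residueUnion.symm.trans hdim).le
  have h1 := hy'.notMem_of_height_eq_one (by omega) hq hle le_rfl
  rw [← hTW] at h1
  have h2 := (hy'.step j).mem
  exact hy'.inv_notMem_seqUnion h2 (hy'.step j).ne_zero
    (LocalSubring.inv_mem (A := T) (le_seqUnion (residueSeq h.le) j h2.1) h1)

end DirectedChain

end Sequence

/-! ### The main theorem -/

theorem theorem7 {K : Type*} [Field K] (d : ℕ) (hd : 2 ≤ d)
    (R : ℕ → LocalSubring K) [IsFractionRing (R 0).toSubring K]
    (hR : IsQuadraticSequence d R)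
    (x : (R 0).toSubring) [(Ideal.span {x}).IsPrime]
    (hxm : x ∈ maximalIdeal (R 0).toSubring) (hxm2 : x ∉ maximalIdeal (R 0).toSubring ^ 2)
    (hS : seqUnion R ≤ (LocalSubring.ofPrime (R 0).toSubring (Ideal.span {x})).toSubring) :
    (∀ n, IsPrimeTransform (Ideal.span {x}) (RingHom.ker (residueMap hS n))) ∧
    seqUnion (residueSeq hS) =
      (algebraMap (ResidueUnion hS) (FractionRing (ResidueUnion hS))).range ∧
    IsQuadraticSequence (d - 1) (residueSeq hS) ∧
    List.TFAE [
      HeightOneDirected R,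
      ValuationRing (seqUnion R),
      ValuationRing (ResidueUnion hS) ∧ ringKrullDim (ResidueUnion hS) = 1 ∧
        ∃ ν : AddValuation (FractionRing (ResidueUnion hS)) (WithTop ℝ),
          IsAssociatedRealValuation
            (algebraMap (ResidueUnion hS) (FractionRing (ResidueUnion hS))).range ν ∧
          ValueSumDiverges (residueSeq hS) ν] ∧
    (3 ≤ d →
      (HeightOneDirected R ↔
        SwitchesStronglyInfinitelyOften (residueSeq hS) ∧
        ∀ ν : AddValuation (FractionRing (ResidueUnion hS)) (WithTop ℝ),
          IsAssociatedRealValuation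
            (algebraMap (ResidueUnion hS) (FractionRing (ResidueUnion hS))).range ν →
          ValueSumDiverges (residueSeq hS) ν)) := by
  obtain ⟨y, hy⟩ := hR.exists_quadChain (by omega)
  obtain ⟨X, -, h⟩ := hy.exists_directedChain hd x hxm hxm2 hS
  have h12 := h.valuationRing_of_heightOneDirected
  have h23 : ValuationRing (seqUnion R) →
      ValuationRing (ResidueUnion hS) ∧ ringKrullDim (ResidueUnion hS) = 1 := by
    intro hval
    have hT : ValuationRing (ResidueUnion hS) :=
      Function.Surjective.valuationRing (Ideal.Quotient.mk (centerIdeal hS))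
        Ideal.Quotient.mk_surjective
    exact ⟨hT, h.ringKrullDim_residueUnion_eq_one⟩
  refine ⟨fun n => ?_, h.seqUnion_residueSeq_eq, h.isQuadraticSequence_residueSeq, ?_, fun hd3 => ?_⟩
  · have := h.isPrimeTransform n
    rwa [LocalSubring.center_ofPrime] at this
  · tfae_have 1 → 2 := h12
    tfae_have 2 → 3 := by
      intro hval
      obtain ⟨hT, hdim⟩ := h23 hval
      obtain ⟨ν, hν⟩ := ValuationRing.exists_real_addValuation (ResidueUnion hS)
        (FractionRing (ResidueUnion hS)) hdim
      exact ⟨hT, hdim, ν, hν, DirectedChain.valueSumDiverges_of_valuationRing (h := h) hν⟩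
    tfae_have 3 → 1 := fun ⟨_, _, ν, hν, hdiv⟩ =>
      DirectedChain.heightOneDirected_of_valueSumDiverges (h := h) hν hdiv
    tfae_finish
  · constructor
    · intro h1
      have hval := h12 h1
      obtain ⟨hT, hdim⟩ := h23 hval
      exact ⟨h.switches_residueSeq hd3 hdim, fun ν hν =>
        DirectedChain.valueSumDiverges_of_valuationRing (h := h) hν⟩
    · rintro ⟨hsw, hall⟩
      obtain ⟨y', hy'⟩ := h.exists_quadChain_residueSeq
      have hT := h.valuationRing_residueUnion_iff.2 (hy'.valuationRing_of_switches hsw)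
      have hdim : ringKrullDim (ResidueUnion hS) = 1 :=
        h.ringKrullDim_residueUnion.trans (hy'.ringKrullDim_eq_one_of_switches hsw)
      -- Divergence is assumed for every associated ν; rank one guarantees that there is one.
      obtain ⟨ν, hν⟩ := ValuationRing.exists_real_addValuation (ResidueUnion hS)
        (FractionRing (ResidueUnion hS)) hdim
      exact DirectedChain.heightOneDirected_of_valueSumDiverges (h := h) hν (hall ν hν)
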